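/- Let $1<p<\infty$ and let $L_p=L_p([0,1])$ be the real Lebesgue space with Lebesgue measure and norm $\|\cdot\|_p$. Let $H_1=\mathbf 1_{[0,1)}$ and, for $k=2^n+l$ with $n\ge 0$ and $1\le l\le 2^n$, let $H_k$ equal $2^{n/2}$ on $[(2l-2)2^{-n-1},(2l-1)2^{-n-1})$, $-2^{n/2}$ on $[(2l-1)2^{-n-1},2l\,2^{-n-1})$, and $0$ elsewhere. Put $H_{k,p}=H_k/\|H_k\|_p$. Then $\mathcal H_p=\{H_{k,p}\}_{k\ge1}$ is a Schauder basis of $L_p$; write $f=\sum_{k=1}^\infty c_k(f)H_{k,p}$. Let $A_1$ be the closure in $L_p$ of the convex hull of $\{\pm H_{k,p}: k\ge 1\}$ and let $\|f\|_{A_1}=\inf\{M>0: f/M\in A_1\}$ (with $\inf\emptyset=\infty$). A decreasing ordering of $f$ is a sequence $\varrho=(k_j)_{j\ge1}$ of distinct positive integers, containing every $k$ with $c_k(f)\neq0$, such that $|c_{k_1}(f)|\ge|c_{k_2}(f)|\ge\cdots$; it is a decreasing permutation if it contains every positive integer. Let $G_m(f,\varrho)=\sum_{j=1}^m c_{k_j}(f)H_{k_j,p}$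 and, for $0\le\alpha\le1$, $$\gamma_m(\alpha,p,\mathcal H_p)=\sup_{f\ne0,\ \|f\|_{A_1}<\infty}\ \sup_{\varrho}\ \frac{\|f-G_m(f,\varrho)\|_p}{\|f\|_p^{1-\alpha}\,\|f\|_{A_1}^{\alpha}},$$ where $\varrho$ runs over the decreasing orderings of $f$; let $\gamma_m^{\rm perm}(\alpha,p,\mathcal H_p)$ be the same quantity with $\varrho$ restricted to decreasing permutations of $f$. Then there are constants $c,C>0$ depending only on $p$ such that, for all $\alpha\in[0,1]$ and all integers $m\ge1$, $$c\,m^{-\alpha(1-1/p)}\le\gamma_m^{\rm perm}(\alpha,p,\mathcal H_p)\le\gamma_m(\alpha,p,\mathcal H_p)\le C\,m^{-\alpha(1-1/p)}.$$ In particular, if $p>2$ and $0<\alpha\le1$, then $m^{\alpha/2}\,\gamma_m(\alpha,p,\mathcal H_p)\to0$ as $m\to\infty$. -/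

import Mathlib

open MeasureTheory Set Filter Topology
open scoped ENNReal

noncomputable section

section General

variable {X : Type*} [NormedAddCommGroup X] [NormedSpace ℝ X]

/-- `A₁(D)`: the closure of the convex hull of the symmetrized dictionary `D ∪ (-D)`. -/
def A1Set (D : Set X) : Set X := closure (convexHull ℝ (D ∪ -D))

/-- `‖f‖_{A₁(D)} = inf {M > 0 : f / M ∈ A₁(D)}`, with value `∞` when there is no such `M`. -/
def A1Norm (D : Set X) (f : X) : ℝ≥0∞ :=
  ⨅ M : {M : ℝ // 0 < M ∧ M⁻¹ • f ∈ A1Set D}, ENNReal.ofReal (M : ℝ)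

/-- The decreasing permutations of `f`: the bijections `k` of the index set with
`|c_{k 0}(f)| ≥ |c_{k 1}(f)| ≥ …`. There are none if `f` has infinitely many nonzero
coefficients and also a zero coefficient. -/
def decreasingPermutations (b : SchauderBasis ℝ X) (f : X) : Set (ℕ → ℕ) :=
  {k | Function.Bijective k ∧ Antitone fun j => |b.coord (k j) f|}

/-- The decreasing orderings of `f`: as for decreasing permutations, except that indices with
zero coefficient may be left out. If `c_n(f) → 0`, as for every semi-normalized basis,
there is at least one. -/
def decreasingOrderings (b : SchauderBasis ℝ X) (f : X) : Set (ℕ → ℕ) :=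
  {k | Function.Injective k ∧ (∀ n, b.coord n f ≠ 0 → n ∈ range k) ∧
    Antitone fun j => |b.coord (k j) f|}

/-- The `m`-th greedy approximant `∑_{j < m} c_{k j}(f) ψ_{k j}` along the ordering `k`. -/
def greedyApprox (b : SchauderBasis ℝ X) (m : ℕ) (k : ℕ → ℕ) (f : X) : X :=
  ∑ j ∈ Finset.range m, b.coord (k j) f • b (k j)

/-- The supremum of `‖f - G_m(f, Ψ, k)‖ / (‖f‖ ^ (1 - α) * ‖f‖_{A₁(Ψ)} ^ α)` over all `f ≠ 0`
with `‖f‖_{A₁(Ψ)} < ∞` and all orderings `k ∈ D f`. -/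
def greedyGammaOn (b : SchauderBasis ℝ X) (D : X → Set (ℕ → ℕ)) (α : ℝ) (m : ℕ) : ℝ≥0∞ :=
  ⨆ (f : X) (_ : f ≠ 0) (_ : A1Norm (range b) f < ∞) (k : ℕ → ℕ) (_ : k ∈ D f),
    ‖f - greedyApprox b m k f‖ₑ / (‖f‖ₑ ^ (1 - α) * A1Norm (range b) f ^ α)

/-- `γ_m(α, X, Ψ)`, with the supremum over all decreasing orderings. -/
def greedyGamma (b : SchauderBasis ℝ X) (α : ℝ) (m : ℕ) : ℝ≥0∞ :=
  greedyGammaOn b (decreasingOrderings b) α m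

/-- `γ_m(α, X, Ψ)`, with the supremum over decreasing permutations only. -/
def greedyGammaPerm (b : SchauderBasis ℝ X) (α : ℝ) (m : ℕ) : ℝ≥0∞ :=
  greedyGammaOn b (decreasingPermutations b) α m

end General

/-- The `L₂`-normalized Haar function of level `n` and position `l` (`1 ≤ l ≤ 2 ^ n`). -/
def haarAt (n l : ℕ) (x : ℝ) : ℝ :=
  if x ∈ Ico ((2 * (l : ℝ) - 2) / 2 ^ (n + 1)) ((2 * (l : ℝ) - 1) / 2 ^ (n + 1)) then
    (2 : ℝ) ^ ((n : ℝ) / 2)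
  else if x ∈ Ico ((2 * (l : ℝ) - 1) / 2 ^ (n + 1)) (2 * (l : ℝ) / 2 ^ (n + 1)) then
    -(2 : ℝ) ^ ((n : ℝ) / 2)
  else 0

/-- The Haar system, indexed from `0`: `haar j` is the classical `H_{j+1}`. Thus `haar 0` is `1` on
`[0, 1)`, and for `j + 1 = 2 ^ n + l` with `1 ≤ l ≤ 2 ^ n` one has `n = Nat.log 2 j` and
`haar j = haarAt n l`. -/
def haar (j : ℕ) : ℝ → ℝ :=
  if j = 0 then (Ico (0 : ℝ) 1).indicator fun _ => 1
  else haarAt (Nat.log 2 j) (j + 1 - 2 ^ Nat.log 2 j)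

/-- Lebesgue measure on `[0, 1]`. -/
abbrev lebesgue01 : Measure ℝ := volume.restrict (Icc (0 : ℝ) 1)

/-- The real Banach space `L_p([0, 1])`. -/
abbrev Lp01 (p : ℝ≥0∞) : Type := Lp ℝ p lebesgue01

theorem memLp_haar (p : ℝ≥0∞) (j : ℕ) : MemLp (haar j) p lebesgue01 := by
  unfold haar
  split_ifs with h
  · exact (memLp_const (1 : ℝ)).indicator measurableSet_Ico
  · refine MemLp.of_bound (C := (2 : ℝ) ^ ((Nat.log 2 j : ℝ) / 2)) ?_ ?_
    · exact (Measurable.ite measurableSet_Ico measurable_const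
        (Measurable.ite measurableSet_Ico measurable_const
          measurable_const)).aestronglyMeasurable
    · have h0 : (0 : ℝ) ≤ (2 : ℝ) ^ ((Nat.log 2 j : ℝ) / 2) := by positivity
      refine Eventually.of_forall fun x => ?_
      unfold haarAt
      split_ifs <;> simp [abs_of_nonneg h0, h0]

/-- The class of `haar j` in `L_p([0, 1])`. -/
def haarClass (p : ℝ≥0∞) (j : ℕ) : Lp01 p := (memLp_haar p j).toLp (haar j)

/-- The `L_p`-normalized Haar system, `haar j / ‖haar j‖_p`. -/
def haarLp (p : ℝ≥0∞) (j : ℕ) : Lp01 p := ‖haarClass p j‖⁻¹ • haarClass p j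

end

/-! Write θ = 1/p. The upper estimate rests on two properties of the normalized Haar system: it is
unconditional, and N of its members with coefficients at most t in modulus have a sum of norm at
most D t N^θ. The first gives ‖f - G_m‖ ≤ (1 + K)‖f‖. For the second, the coefficients have ℓ₁ norm
at most ‖f‖_{A₁}, so the j-th largest is at most ‖f‖_{A₁}/j; cutting the remainder into dyadic
blocks of ranks and summing a geometric series gives ‖f - G_m‖ ≤ C m^{-(1-θ)} ‖f‖_{A₁}. The
geometric mean of the two bounds with weights 1 - α and α is the upper estimate (`greedyGamma_le`).
The order is attained by a sum of 2m Haar functions of one level, whose disjoint supports make the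
norms explicit (`le_greedyGammaPerm`).

Unconditionality comes from Burkholder's inequality for ±1 transforms of dyadic martingales
(`exists_integral_abs_haarSum_rpow_le`). The function U(x, y) = (|y| - β|x|)(|x| + |y|)^{p-1} is
concave along lines of slope ±1, so adding a Haar term to both sums cannot increase the integral of
U; that integral starts nonpositive, and 2U dominates |y|^p - K|x|^p.

The cardinality bound (`exists_norm_sum_haarLp_le_card`) holds because, apart from the constant
function, the normalized Haar functions that do not vanish at a given point have as moduli distinct
powers of 2^{1/p} there, so the p-th power of their sum is controlled by the sum of their p-th
powers.

Unconditionality restricted to initial segments, together with density of the span, also yields the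
Schauder basis property through Grünblum's criterion (`exists_schauderBasis_of_norm_sum_le`). -/

/-! ### A Burkholder function -/

/-- For `s > 0` and `r ∈ [0, 1]`, `s r - r ^ s` lies between `0` and `s - 1`. -/
theorem mul_sub_rpow_mul_le {s r B M : ℝ} (hs : 0 < s) (hr0 : 0 ≤ r) (hr1 : r ≤ 1)
    (hM : 0 ≤ M) (hB : B * (s - 1) ≤ M) : B * (s * r - r ^ s) ≤ M := by
  have hr : r = 1 + (r - 1) := by ring
  rcases le_total 1 s with h | h
  -- Bernoulli's inequality gives the bound by s - 1, monotonicity in the exponent the comparison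
  -- with 0; both are needed because B may have either sign.
  · have h1 : 1 + s * (r - 1) ≤ r ^ s := by
      have := one_add_mul_self_le_rpow_one_add (s := r - 1) (by linarith) h
      rwa [← hr] at this
    have h2 : r ^ s ≤ r := by
      simpa using Real.rpow_le_rpow_of_exponent_ge' hr0 hr1 (by norm_num) h
    rcases le_total 0 B with hB0 | hB0 <;> nlinarith
  · have h1 : r ^ s ≤ 1 + s * (r - 1) := by
      have := rpow_one_add_le_one_add_mul_self (s := r - 1) (by linarith) hs.le h
      rwa [← hr] at this
    have h2 : r ≤ r ^ s := by
      simpa using Real.rpow_le_rpow_of_exponent_ge' hr0 hr1 hs.le h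
    rcases le_total 0 B with hB0 | hB0 <;> nlinarith

/-- The profile of the Burkholder function along a diagonal, outside of the interval on which it
is affine and after subtraction of the affine part. -/
noncomputable def diagonalProfile (p A B d v : ℝ) : ℝ :=
  -A * v ^ p + B * d * v ^ (p - 1) - B * v * d ^ (p - 1)

theorem hasDerivAt_diagonalProfile {p A B d v : ℝ} (hv : 0 < v) :
    HasDerivAt (diagonalProfile p A B d)
      (-A * (p * v ^ (p - 1)) + B * d * ((p - 1) * v ^ (p - 1 - 1)) - B * d ^ (p - 1)) v := by
  unfold diagonalProfile
  have h1 := (Real.hasDerivAt_rpow_const (x := v) (p := p) (Or.inl hv.ne')).const_mul (-A)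
  have h2 := (Real.hasDerivAt_rpow_const (x := v) (p := p - 1) (Or.inl hv.ne')).const_mul (B * d)
  have h3 := ((hasDerivAt_id v).const_mul B).mul_const (d ^ (p - 1))
  convert! (h1.add h2).sub h3 using 1
  simp

theorem continuous_diagonalProfile {p A B d : ℝ} (hp : 1 < p) :
    Continuous (diagonalProfile p A B d) := by
  unfold diagonalProfile
  have h1 : Continuous fun v : ℝ => v ^ p := Real.continuous_rpow_const (by linarith)
  have h2 : Continuous fun v : ℝ => v ^ (p - 1) := Real.continuous_rpow_const (by linarith)
  fun_prop

/-- The second derivative is (p - 1) v^{p-3} (B(p - 2)d - Apv), and d ≤ v. -/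
theorem concaveOn_diagonalProfile {p A B d : ℝ} (hp : 1 < p) (hA : 0 ≤ A)
    (hAB : B * (p - 2) ≤ A * p) (hd : 0 ≤ d) :
    ConcaveOn ℝ (Ici d) (diagonalProfile p A B d) := by
  refine concaveOn_of_hasDerivWithinAt2_nonpos (convex_Ici d)
    (continuous_diagonalProfile hp).continuousOn
    (f' := fun v => -A * (p * v ^ (p - 1)) + B * d * ((p - 1) * v ^ (p - 1 - 1)) - B * d ^ (p - 1))
    (f'' := fun v => -A * (p * ((p - 1) * v ^ (p - 1 - 1))) +
      B * d * ((p - 1) * ((p - 1 - 1) * v ^ (p - 1 - 1 - 1)))) ?_ ?_ ?_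
  · intro v hv
    rw [interior_Ici] at hv
    exact (hasDerivAt_diagonalProfile (hd.trans_lt hv)).hasDerivWithinAt
  · intro v hv
    rw [interior_Ici] at hv
    have hv0 : 0 < v := hd.trans_lt hv
    have h1 := ((Real.hasDerivAt_rpow_const (x := v) (p := p - 1)
      (Or.inl hv0.ne')).const_mul p).const_mul (-A)
    have h2 := ((Real.hasDerivAt_rpow_const (x := v) (p := p - 1 - 1)
      (Or.inl hv0.ne')).const_mul (p - 1)).const_mul (B * d)
    exact ((h1.add h2).sub_const _).hasDerivWithinAt
  · intro v hv
    rw [interior_Ici] at hv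
    have hv0 : 0 < v := hd.trans_lt hv
    have hpow : v ^ (p - 1 - 1) = v ^ (p - 1 - 1 - 1) * v := by
      rw [← Real.rpow_add_one hv0.ne']; ring_nf
    have hpos : 0 < v ^ (p - 1 - 1 - 1) := Real.rpow_pos_of_pos hv0 _
    have key : B * (p - 2) * d ≤ A * p * v :=
      (mul_le_mul_of_nonneg_right hAB hd).trans
        (mul_le_mul_of_nonneg_left (le_of_lt hv) (by positivity))
    have : (p - 1) * v ^ (p - 1 - 1 - 1) * (B * (p - 2) * d - A * p * v) ≤ 0 :=
      mul_nonpos_of_nonneg_of_nonpos (by nlinarith) (by linarith)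
    rw [hpow]
    linarith

/-- After division by v^{p-1} the derivative becomes B((p - 1)r - r^{p-1}) - Ap with r = d/v in [0,
1], which `mul_sub_rpow_mul_le` controls. -/
theorem antitoneOn_diagonalProfile {p A B d : ℝ} (hp : 1 < p) (hA : 0 ≤ A)
    (hAB : B * (p - 2) ≤ A * p) (hd : 0 ≤ d) :
    AntitoneOn (diagonalProfile p A B d) (Ici d) := by
  refine antitoneOn_of_hasDerivWithinAt_nonpos (convex_Ici d)
    (continuous_diagonalProfile hp).continuousOn
    (f' := fun v => -A * (p * v ^ (p - 1)) + B * d * ((p - 1) * v ^ (p - 1 - 1)) - B * d ^ (p - 1))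
    ?_ ?_
  · intro v hv
    rw [interior_Ici] at hv
    exact (hasDerivAt_diagonalProfile (hd.trans_lt hv)).hasDerivWithinAt
  · intro v hv
    rw [interior_Ici] at hv
    have hv0 : 0 < v := hd.trans_lt hv
    have hpow : v ^ (p - 1) = v ^ (p - 1 - 1) * v := by
      rw [← Real.rpow_add_one hv0.ne']; ring_nf
    have hdpow : d ^ (p - 1) = (d / v) ^ (p - 1) * v ^ (p - 1) := by
      rw [← Real.mul_rpow (by positivity) hv0.le, div_mul_cancel₀ _ hv0.ne']
    have key : B * ((p - 1) * (d / v) - (d / v) ^ (p - 1)) ≤ A * p :=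
      mul_sub_rpow_mul_le (by linarith) (by positivity) (div_le_one_of_le₀ (le_of_lt hv) hv0.le)
        (by positivity) (by convert hAB using 2; ring)
    have hd' : d * v ^ (p - 1 - 1) = (d / v) * v ^ (p - 1) := by
      rw [hpow]; field_simp
    have hpos : 0 < v ^ (p - 1) := Real.rpow_pos_of_pos hv0 _
    have := mul_le_mul_of_nonneg_right key hpos.le
    have e : B * d * ((p - 1) * v ^ (p - 1 - 1)) = B * (p - 1) * ((d / v) * v ^ (p - 1)) := by
      rw [← hd']; ring
    rw [e, hdpow]
    linarith

/-- A decreasing concave function composed with the convex function max(·, d) is concave. -/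
theorem diagonalProfile_max_add_le {p A B d : ℝ} (hp : 1 < p) (hA : 0 ≤ A)
    (hAB : B * (p - 2) ≤ A * p) (hd : 0 ≤ d) (u h : ℝ) :
    diagonalProfile p A B d (max (u + h) d) + diagonalProfile p A B d (max (u - h) d) ≤
      2 * diagonalProfile p A B d (max u d) := by
  have hc := (concaveOn_diagonalProfile hp hA hAB hd).2 (mem_Ici.2 (le_max_right (u + h) d))
    (mem_Ici.2 (le_max_right (u - h) d)) (one_half_pos (α := ℝ)).le
    (one_half_pos (α := ℝ)).le (add_halves 1)
  have hm : max u d ≤ (1 / 2 : ℝ) • max (u + h) d + (1 / 2 : ℝ) • max (u - h) d := by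
    simp only [smul_eq_mul]
    apply max_le
    · linarith [le_max_left (u + h) d, le_max_left (u - h) d]
    · linarith [le_max_right (u + h) d, le_max_right (u - h) d]
  have ha := antitoneOn_diagonalProfile hp hA hAB hd (mem_Ici.2 (le_max_right u d))
    (mem_Ici.2 ((le_max_right u d).trans hm)) hm
  simp only [smul_eq_mul] at hc ha
  linarith

/-- A Burkholder function: `(|y| - β |x|) (|x| + |y|) ^ (p - 1)`. -/
noncomputable def burkholder (p β x y : ℝ) : ℝ := (|y| - β * |x|) * (|x| + |y|) ^ (p - 1)

/-- On the line y - x = 2d one has |x| + |y| = 2 max(|u|, d), so the function is affine for |u| ≤ d.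
Each profile is the correction on one of the two outer rays and is constant elsewhere. -/
theorem burkholder_diagonal {p β d : ℝ} (hp : 1 < p) (hd : 0 ≤ d) (u : ℝ) :
    burkholder p β (u - d) (u + d) = 2 ^ (p - 1) *
      (diagonalProfile p (β - 1) (β + 1) d (max u d) +
        diagonalProfile p (β - 1) (-(β + 1)) d (max (-u) d) +
        ((β + 1) * u * d ^ (p - 1) + (β - 1) * d ^ p)) := by
  have hpow : ∀ v : ℝ, 0 ≤ v → v ^ p = v ^ (p - 1) * v := fun v hv => by
    conv_lhs => rw [← sub_add_cancel p 1]
    exact Real.rpow_add_one' hv (by linarith)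
  unfold burkholder diagonalProfile
  rcases le_total d u with h | h
  · rw [max_eq_left h, max_eq_right (by linarith), abs_of_nonneg (by linarith : 0 ≤ u - d),
      abs_of_nonneg (by linarith : 0 ≤ u + d), show u - d + (u + d) = 2 * u by ring,
      Real.mul_rpow (by norm_num) (by linarith), hpow u (by linarith), hpow d hd]
    ring
  · rcases le_total (-u) d with h' | h'
    · rw [max_eq_right h, max_eq_right h', abs_of_nonpos (by linarith : u - d ≤ 0),
        abs_of_nonneg (by linarith : 0 ≤ u + d), show -(u - d) + (u + d) = 2 * d by ring,
        Real.mul_rpow (by norm_num) hd, hpow d hd]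
      ring
    · rw [max_eq_right h, max_eq_left h', abs_of_nonpos (by linarith : u - d ≤ 0),
        abs_of_nonpos (by linarith : u + d ≤ 0), show -(u - d) + -(u + d) = 2 * -u by ring,
        Real.mul_rpow (by norm_num) (by linarith), hpow d hd, hpow (-u) (by linarith)]
      ring

theorem burkholder_neg_right (p β x y : ℝ) : burkholder p β x (-y) = burkholder p β x y := by
  simp [burkholder]

theorem burkholder_neg_neg (p β x y : ℝ) : burkholder p β (-x) (-y) = burkholder p β x y := by
  simp [burkholder]

section Burkholder

variable {p β : ℝ}

theorem burkholder_add_add_le (hp : 1 < p) (hβ : 1 ≤ β)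
    (h1 : (β + 1) * (p - 2) ≤ (β - 1) * p) (h2 : -(β + 1) * (p - 2) ≤ (β - 1) * p) (x y h : ℝ) :
    burkholder p β (x + h) (y + h) + burkholder p β (x - h) (y - h) ≤ 2 * burkholder p β x y := by
  have key : ∀ d : ℝ, 0 ≤ d → ∀ u h : ℝ, burkholder p β (u + h - d) (u + h + d) +
      burkholder p β (u - h - d) (u - h + d) ≤ 2 * burkholder p β (u - d) (u + d) := by
    intro d hd u h
    have ha := diagonalProfile_max_add_le hp (by linarith) h1 hd u h
    have hb := diagonalProfile_max_add_le hp (by linarith) h2 hd (-u) h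
    rw [burkholder_diagonal hp hd, burkholder_diagonal hp hd, burkholder_diagonal hp hd, ← mul_add,
      mul_left_comm 2]
    refine mul_le_mul_of_nonneg_left ?_ (by positivity)
    rw [show -(u + h) = -u - h by ring, show -(u - h) = -u + h by ring]
    linarith
  -- The diagonal formula needs d ≥ 0; the case y ≤ x is reduced to it by the symmetry (x, y) ↦ (-x,
  -- -y).
  rcases le_total x y with hxy | hxy
  · have := key ((y - x) / 2) (by linarith) ((x + y) / 2) h
    ring_nf at this ⊢
    exact this
  · have := key ((x - y) / 2) (by linarith) (-((x + y) / 2)) h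
    rw [← burkholder_neg_neg p β x y, ← burkholder_neg_neg p β (x + h),
      ← burkholder_neg_neg p β (x - h)]
    ring_nf at this ⊢
    linarith

theorem burkholder_add_sub_le (hp : 1 < p) (hβ : 1 ≤ β)
    (h1 : (β + 1) * (p - 2) ≤ (β - 1) * p) (h2 : -(β + 1) * (p - 2) ≤ (β - 1) * p) (x y h : ℝ) :
    burkholder p β (x + h) (y - h) + burkholder p β (x - h) (y + h) ≤ 2 * burkholder p β x y := by
  have := burkholder_add_add_le hp hβ h1 h2 x (-y) h
  rw [← burkholder_neg_right p β x y, ← burkholder_neg_right p β (x + h),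
    ← burkholder_neg_right p β (x - h)]
  convert this using 3 <;> ring

theorem burkholder_nonpos (hβ : 1 ≤ β) {x y : ℝ} (h : |y| ≤ |x|) : burkholder p β x y ≤ 0 :=
  mul_nonpos_of_nonpos_of_nonneg (by nlinarith [abs_nonneg x]) (by positivity)

theorem abs_rpow_le_burkholder (hp : 1 < p) (hβ : 1 ≤ β) (x y : ℝ) :
    |y| ^ p ≤ 2 * burkholder p β x y +
      ((2 * β) ^ p + 2 * (β * (1 + 2 * β) ^ (p - 1))) * |x| ^ p := by
  have hpow : ∀ v : ℝ, 0 ≤ v → v ^ p = v ^ (p - 1) * v := fun v hv => by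
    conv_lhs => rw [← sub_add_cancel p 1]
    exact Real.rpow_add_one' hv (by linarith)
  have hx := abs_nonneg x
  have hy := abs_nonneg y
  unfold burkholder
  -- If |y| ≥ 2β|x|, then |y| - β|x| ≥ |y|/2 and 2U alone suffices; otherwise every term is at most
  -- a multiple of |x|^p.
  rcases le_total (2 * β * |x|) |y| with h | h
  · have h3 : |y| ^ (p - 1) ≤ (|x| + |y|) ^ (p - 1) :=
      Real.rpow_le_rpow hy (by linarith) (by linarith)
    have h4 : |y| ^ p ≤ 2 * ((|y| - β * |x|) * (|x| + |y|) ^ (p - 1)) := by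
      rw [hpow _ hy]
      have h5 : 0 ≤ |y| ^ (p - 1) := by positivity
      nlinarith
    have : 0 ≤ ((2 * β) ^ p + 2 * (β * (1 + 2 * β) ^ (p - 1))) * |x| ^ p := by positivity
    linarith
  · have h3 : |y| ^ p ≤ (2 * β) ^ p * |x| ^ p := by
      rw [← Real.mul_rpow (by positivity) hx]
      exact Real.rpow_le_rpow hy h (by linarith)
    have h4 : (|x| + |y|) ^ (p - 1) ≤ (1 + 2 * β) ^ (p - 1) * |x| ^ (p - 1) := by
      rw [← Real.mul_rpow (by positivity) hx]
      exact Real.rpow_le_rpow (by positivity) (by linarith) (by linarith)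
    have h5 : -(β * |x|) * (|x| + |y|) ^ (p - 1) ≤ (|y| - β * |x|) * (|x| + |y|) ^ (p - 1) :=
      mul_le_mul_of_nonneg_right (by linarith) (by positivity)
    have h6 : β * |x| * (|x| + |y|) ^ (p - 1) ≤ β * (1 + 2 * β) ^ (p - 1) * |x| ^ p := by
      rw [hpow _ hx]
      calc _ ≤ β * |x| * ((1 + 2 * β) ^ (p - 1) * |x| ^ (p - 1)) :=
            mul_le_mul_of_nonneg_left h4 (by positivity)
        _ = _ := by ring
    linarith

theorem continuous_burkholder (hp : 1 < p) : Continuous fun z : ℝ × ℝ => burkholder p β z.1 z.2 := by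
  unfold burkholder
  refine Continuous.mul (by fun_prop) (Continuous.rpow_const (by fun_prop) fun _ => Or.inr ?_)
  linarith

/-- For `1 < p` there are a continuous function `U` and a constant `K` with the properties that
drive Burkholder's inequality for `±1` transforms of dyadic martingales. -/
theorem exists_burkholder_function (hp : 1 < p) : ∃ (U : ℝ → ℝ → ℝ) (K : ℝ), 0 ≤ K ∧
    (Continuous fun z : ℝ × ℝ => U z.1 z.2) ∧
    (∀ x y, |y| ≤ |x| → U x y ≤ 0) ∧
    (∀ x y, |y| ^ p ≤ 2 * U x y + K * |x| ^ p) ∧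
    (∀ x y h k, k = h ∨ k = -h → U (x + h) (y + k) + U (x - h) (y - k) ≤ 2 * U x y) := by
  have hp0 : 0 < p - 1 := by linarith
  -- The two concavity conditions amount to β ≥ p - 1 and β ≥ 1/(p - 1). This choice satisfies both,
  -- and β ≥ 1, without optimizing the constant.
  obtain ⟨β, hβ⟩ : ∃ β : ℝ, β = p + 1 / (p - 1) := ⟨_, rfl⟩
  have hi : 1 / (p - 1) * (p - 1) = 1 := by field_simp
  have hi0 : 0 < 1 / (p - 1) := by positivity
  have hβ1 : 1 ≤ β := by linarith
  have h1 : (β + 1) * (p - 2) ≤ (β - 1) * p := by nlinarith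
  have h2 : -(β + 1) * (p - 2) ≤ (β - 1) * p := by nlinarith
  refine ⟨burkholder p β, (2 * β) ^ p + 2 * (β * (1 + 2 * β) ^ (p - 1)), by positivity,
    continuous_burkholder hp, fun x y => burkholder_nonpos hβ1,
    abs_rpow_le_burkholder hp hβ1, ?_⟩
  rintro x y h k (rfl | rfl)
  · exact burkholder_add_add_le hp hβ1 h1 h2 x y k
  · rw [sub_neg_eq_add, ← sub_eq_add_neg]
    exact burkholder_add_sub_le hp hβ1 h1 h2 x y h

end Burkholder

/-! ### Dyadic intervals and the structure of the Haar functions -/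

/-- The dyadic interval `[q / 2 ^ n, (q + 1) / 2 ^ n)`. -/
def dyadicIco (n q : ℕ) : Set ℝ := Ico ((q : ℝ) / 2 ^ n) (((q : ℝ) + 1) / 2 ^ n)

theorem mem_dyadicIco {n q : ℕ} {x : ℝ} : x ∈ dyadicIco n q ↔ ⌊2 ^ n * x⌋ = (q : ℤ) := by
  rw [dyadicIco, mem_Ico, Int.floor_eq_iff, div_le_iff₀' (by positivity),
    lt_div_iff₀' (by positivity)]
  simp

theorem measurableSet_dyadicIco (n q : ℕ) : MeasurableSet (dyadicIco n q) := measurableSet_Ico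

theorem dyadicIco_unique {n q r : ℕ} {x : ℝ} (hq : x ∈ dyadicIco n q) (hr : x ∈ dyadicIco n r) :
    q = r := by
  rw [mem_dyadicIco] at hq hr
  exact_mod_cast hq.symm.trans hr

theorem left_mem_dyadicIco (n q : ℕ) : (q : ℝ) / 2 ^ n ∈ dyadicIco n q := by
  refine left_mem_Ico.2 ?_
  gcongr
  linarith

theorem dyadicIco_parent {n q : ℕ} {x : ℝ} (hx : x ∈ dyadicIco (n + 1) q) :
    x ∈ dyadicIco n (q / 2) := by
  rw [mem_dyadicIco, Int.floor_eq_iff] at hx ⊢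
  obtain ⟨h1, h2⟩ := hx
  have e : (2 : ℝ) ^ (n + 1) * x = 2 * (2 ^ n * x) := by ring
  rw [e] at h1 h2
  rw [Int.cast_natCast] at h1 h2 ⊢
  have h3 : ((q / 2 : ℕ) : ℝ) * 2 ≤ q := by exact_mod_cast Nat.div_mul_le_self q 2
  have h4 : (q : ℝ) + 1 ≤ 2 * ((q / 2 : ℕ) : ℝ) + 2 := by
    exact_mod_cast (by omega : q + 1 ≤ 2 * (q / 2) + 2)
  constructor <;> linarith

theorem dyadicIco_ancestor {n q : ℕ} (k : ℕ) {x : ℝ} (hx : x ∈ dyadicIco (n + k) q) :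
    x ∈ dyadicIco n (q / 2 ^ k) := by
  induction k generalizing q with
  | zero => simpa using hx
  | succ k ih =>
    have := ih (dyadicIco_parent hx)
    rwa [Nat.div_div_eq_div_mul, ← pow_succ'] at this

theorem dyadicIco_children {n q : ℕ} {x : ℝ} (hx : x ∈ dyadicIco n q) :
    x ∈ dyadicIco (n + 1) (2 * q) ∨ x ∈ dyadicIco (n + 1) (2 * q + 1) := by
  rw [mem_dyadicIco, Int.floor_eq_iff] at *
  rw [mem_dyadicIco, Int.floor_eq_iff]
  obtain ⟨h1, h2⟩ := hx
  have e : (2 : ℝ) ^ (n + 1) * x = 2 * (2 ^ n * x) := by ring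
  rw [e]
  push_cast at h1 h2 ⊢
  rcases lt_or_ge (2 * (2 ^ n * x)) (2 * q + 1 : ℝ) with h | h
  · left; constructor <;> linarith
  · right; constructor <;> linarith

theorem exists_mem_dyadicIco (n : ℕ) {x : ℝ} (hx : x ∈ Ico (0 : ℝ) 1) :
    ∃ q < 2 ^ n, x ∈ dyadicIco n q := by
  have h0 : 0 ≤ 2 ^ n * x := mul_nonneg (by positivity) hx.1
  refine ⟨⌊2 ^ n * x⌋₊, ?_, ?_⟩
  · rw [Nat.floor_lt h0]
    push_cast
    nlinarith [hx.2, pow_pos (zero_lt_two (α := ℝ)) n]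
  · rw [mem_dyadicIco, Int.natCast_floor_eq_floor h0]

theorem dyadicIco_subset {n q : ℕ} (hq : q < 2 ^ n) : dyadicIco n q ⊆ Ico 0 1 := by
  refine Ico_subset_Ico (by positivity) ?_
  rw [div_le_one (by positivity)]
  exact_mod_cast hq

theorem measureReal_dyadicIco {n q : ℕ} (hq : q < 2 ^ n) :
    lebesgue01.real (dyadicIco n q) = 1 / 2 ^ n := by
  rw [measureReal_restrict_apply (measurableSet_dyadicIco n q),
    inter_eq_left.2 ((dyadicIco_subset hq).trans Ico_subset_Icc_self), dyadicIco,
    Real.volume_real_Ico_of_le (by gcongr; linarith)]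
  ring

theorem haar_zero : haar 0 = (dyadicIco 0 0).indicator fun _ => 1 := by
  simp [haar, dyadicIco]

theorem haar_two_pow_add {n q : ℕ} (hq : q < 2 ^ n) :
    haar (2 ^ n + q) = (dyadicIco (n + 1) (2 * q)).indicator (fun _ => (2 : ℝ) ^ ((n : ℝ) / 2)) -
      (dyadicIco (n + 1) (2 * q + 1)).indicator (fun _ => (2 : ℝ) ^ ((n : ℝ) / 2)) := by
  have hlog : Nat.log 2 (2 ^ n + q) = n :=
    Nat.log_eq_of_pow_le_of_lt_pow (by omega) (by rw [pow_succ]; omega)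
  have hne : 2 ^ n + q ≠ 0 := by positivity
  have hl : 2 ^ n + q + 1 - 2 ^ n = q + 1 := by omega
  ext x
  have hdisj : x ∈ dyadicIco (n + 1) (2 * q) → x ∉ dyadicIco (n + 1) (2 * q + 1) :=
    fun h h' => by have := dyadicIco_unique h h'; omega
  have e1 : Ico ((2 * ((q + 1 : ℕ) : ℝ) - 2) / 2 ^ (n + 1)) ((2 * ((q + 1 : ℕ) : ℝ) - 1) / 2 ^ (n + 1)) =
      dyadicIco (n + 1) (2 * q) := by
    unfold dyadicIco; push_cast; congr 2 <;> ring
  have e2 : Ico ((2 * ((q + 1 : ℕ) : ℝ) - 1) / 2 ^ (n + 1)) (2 * ((q + 1 : ℕ) : ℝ) / 2 ^ (n + 1)) =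
      dyadicIco (n + 1) (2 * q + 1) := by
    unfold dyadicIco; push_cast; congr 2 <;> ring
  simp only [haar, if_neg hne, hlog, hl, haarAt, e1, e2, Pi.sub_apply, indicator]
  split_ifs <;> simp_all

theorem haar_index_cases (j : ℕ) : j = 0 ∨ ∃ n q, q < 2 ^ n ∧ j = 2 ^ n + q := by
  rcases Nat.eq_zero_or_pos j with h | h
  · exact Or.inl h
  · refine Or.inr ⟨Nat.log 2 j, j - 2 ^ Nat.log 2 j, ?_, ?_⟩
    · have := Nat.lt_pow_succ_log_self one_lt_two j
      rw [pow_succ] at this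
      omega
    · have := Nat.pow_log_le_self 2 h.ne'
      omega

theorem measurable_haar (j : ℕ) : Measurable (haar j) := by
  rcases haar_index_cases j with rfl | ⟨n, q, hq, rfl⟩
  · rw [haar_zero]
    exact measurable_const.indicator (measurableSet_dyadicIco _ _)
  · rw [haar_two_pow_add hq]
    exact (measurable_const.indicator (measurableSet_dyadicIco _ _)).sub
      (measurable_const.indicator (measurableSet_dyadicIco _ _))

theorem exists_abs_haar_le (j : ℕ) : ∃ M, ∀ x, |haar j x| ≤ M := by
  rcases haar_index_cases j with rfl | ⟨n, q, hq, rfl⟩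
  · refine ⟨1, fun x => ?_⟩
    rw [haar_zero, indicator]
    split_ifs <;> simp
  · refine ⟨2 ^ ((n : ℝ) / 2) + 2 ^ ((n : ℝ) / 2), fun x => ?_⟩
    have : (0 : ℝ) ≤ 2 ^ ((n : ℝ) / 2) := by positivity
    rw [haar_two_pow_add hq, Pi.sub_apply, indicator, indicator, abs_le]
    constructor <;> split_ifs <;> linarith

/-- The Haar functions that precede `haar (2 ^ n + q)` are constant on its support. -/
theorem haar_eq_of_mem_dyadicIco {n q i : ℕ} (hq : q < 2 ^ n) (hi : i < 2 ^ n + q) {x y : ℝ}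
    (hx : x ∈ dyadicIco n q) (hy : y ∈ dyadicIco n q) : haar i x = haar i y := by
  -- Dyadic intervals are nested, so a coarser interval contains both points or neither.
  have key : ∀ m r, m ≤ n → (x ∈ dyadicIco m r ↔ y ∈ dyadicIco m r) := by
    intro m r hm
    obtain ⟨k, rfl⟩ := Nat.exists_eq_add_of_le hm
    have hx' := dyadicIco_ancestor k hx
    have hy' := dyadicIco_ancestor k hy
    exact ⟨fun h => dyadicIco_unique hx' h ▸ hy', fun h => dyadicIco_unique hy' h ▸ hx'⟩
  have ind : ∀ m r, m ≤ n → ∀ c : ℝ, (dyadicIco m r).indicator (fun _ => c) x =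
      (dyadicIco m r).indicator (fun _ => c) y := by
    intro m r hm c
    by_cases h : x ∈ dyadicIco m r
    · rw [indicator_of_mem h, indicator_of_mem ((key m r hm).1 h)]
    · rw [indicator_of_notMem h, indicator_of_notMem (mt (key m r hm).2 h)]
  rcases haar_index_cases i with rfl | ⟨m, r, hr, rfl⟩
  · rw [haar_zero, ind 0 0 (Nat.zero_le n)]
  · rw [haar_two_pow_add hr]
    have hmn : m ≤ n := by
      by_contra h
      have h1 : 2 ^ (n + 1) ≤ 2 ^ m := Nat.pow_le_pow_right two_pos (by omega)
      rw [pow_succ] at h1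
      omega
    rcases hmn.eq_or_lt with rfl | hlt
    · have hrq : r ≠ q := by omega
      have : ∀ z ∈ dyadicIco m q, ∀ s, s / 2 = r → z ∉ dyadicIco (m + 1) s := by
        intro z hz s hs h
        exact hrq (hs ▸ dyadicIco_unique (dyadicIco_parent h) hz)
      simp [indicator, this x hx (2 * r) (by omega), this x hx (2 * r + 1) (by omega),
        this y hy (2 * r) (by omega), this y hy (2 * r + 1) (by omega)]
    · rw [Pi.sub_apply, Pi.sub_apply, ind _ _ hlt, ind _ _ hlt]

/-! ### One step of a dyadic martingale -/

/-- On the support of the new Haar function the pair (f, g) is a single point, which moves by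
opposite increments on two halves of equal measure; `hU` at that point says that the two changes of
U have nonpositive sum. -/
theorem integral_comp_add_haar_le {U : ℝ → ℝ → ℝ} {f g : ℝ → ℝ} {n q : ℕ} (hq : q < 2 ^ n)
    (hint : Integrable (fun x => U (f x) (g x)) lebesgue01)
    (hf : ∀ x ∈ dyadicIco n q, ∀ y ∈ dyadicIco n q, f x = f y)
    (hg : ∀ x ∈ dyadicIco n q, ∀ y ∈ dyadicIco n q, g x = g y) {a b : ℝ}
    (hU : ∀ x y, U (x + a * 2 ^ ((n : ℝ) / 2)) (y + b * 2 ^ ((n : ℝ) / 2)) +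
      U (x - a * 2 ^ ((n : ℝ) / 2)) (y - b * 2 ^ ((n : ℝ) / 2)) ≤ 2 * U x y) :
    ∫ x, U (f x + a * haar (2 ^ n + q) x) (g x + b * haar (2 ^ n + q) x) ∂lebesgue01 ≤
      ∫ x, U (f x) (g x) ∂lebesgue01 := by
  obtain ⟨x₀, hx₀⟩ : ∃ x₀, x₀ ∈ dyadicIco n q := ⟨_, left_mem_dyadicIco n q⟩
  set s : ℝ := 2 ^ ((n : ℝ) / 2) with hs
  set L := dyadicIco (n + 1) (2 * q) with hL
  set R := dyadicIco (n + 1) (2 * q + 1) with hR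
  set c₁ := U (f x₀ + a * s) (g x₀ + b * s) - U (f x₀) (g x₀) with hc₁
  set c₂ := U (f x₀ - a * s) (g x₀ - b * s) - U (f x₀) (g x₀) with hc₂
  have hLm : MeasurableSet L := measurableSet_dyadicIco _ _
  have hRm : MeasurableSet R := measurableSet_dyadicIco _ _
  have hdec : (fun x => U (f x + a * haar (2 ^ n + q) x) (g x + b * haar (2 ^ n + q) x)) =
      fun x => U (f x) (g x) + (L.indicator (fun _ => c₁) x + R.indicator (fun _ => c₂) x) := by
    ext x
    rw [haar_two_pow_add hq, Pi.sub_apply]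
    by_cases hxL : x ∈ L
    · have hxR : x ∉ R := fun h => by have := dyadicIco_unique hxL h; omega
      have hx : x ∈ dyadicIco n q := by
        have := dyadicIco_parent hxL
        rwa [show 2 * q / 2 = q by omega] at this
      simp only [← hL, ← hR, indicator_of_mem hxL, indicator_of_notMem hxR, hf x hx x₀ hx₀,
        hg x hx x₀ hx₀, hc₁]
      rw [sub_zero, add_zero, add_sub_cancel]
    · by_cases hxR : x ∈ R
      · have hx : x ∈ dyadicIco n q := by
          have := dyadicIco_parent hxR
          rwa [show (2 * q + 1) / 2 = q by omega] at this
        simp only [← hL, ← hR, indicator_of_notMem hxL, indicator_of_mem hxR, hf x hx x₀ hx₀,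
          hg x hx x₀ hx₀, hc₂]
        rw [zero_sub, mul_neg, mul_neg, ← sub_eq_add_neg, ← sub_eq_add_neg, zero_add,
          add_sub_cancel]
      · simp [← hL, ← hR, indicator_of_notMem hxL, indicator_of_notMem hxR]
  have hi₁ : Integrable (L.indicator fun _ => c₁) lebesgue01 := (integrable_const _).indicator hLm
  have hi₂ : Integrable (R.indicator fun _ => c₂) lebesgue01 := (integrable_const _).indicator hRm
  rw [hdec, integral_add (g := fun x => L.indicator (fun _ => c₁) x + R.indicator (fun _ => c₂) x)
    hint (hi₁.add hi₂), integral_add hi₁ hi₂, integral_indicator_const _ hLm,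
    integral_indicator_const _ hRm, measureReal_dyadicIco (by rw [pow_succ]; omega),
    measureReal_dyadicIco (by rw [pow_succ]; omega)]
  have h := hU (f x₀) (g x₀)
  have h' : c₁ + c₂ ≤ 0 := by rw [hc₁, hc₂]; linarith
  have : (1 / 2 ^ (n + 1) : ℝ) • c₁ + (1 / 2 ^ (n + 1) : ℝ) • c₂ ≤ 0 := by
    rw [← smul_add, smul_eq_mul]
    exact mul_nonpos_of_nonneg_of_nonpos (by positivity) h'
  linarith

/-- The partial sum `∑_{i < N} a_i haar_i`. -/
noncomputable def haarSum (a : ℕ → ℝ) (N : ℕ) (x : ℝ) : ℝ := ∑ i ∈ Finset.range N, a i * haar i x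

theorem measurable_haarSum (a : ℕ → ℝ) (N : ℕ) : Measurable (haarSum a N) :=
  Finset.measurable_fun_sum _ fun i _ => (measurable_haar i).const_mul (a i)

theorem exists_abs_haarSum_le (a : ℕ → ℝ) (N : ℕ) : ∃ M, ∀ x, |haarSum a N x| ≤ M := by
  choose M hM using exists_abs_haar_le
  refine ⟨∑ i ∈ Finset.range N, |a i| * M i, fun x => ?_⟩
  refine (Finset.abs_sum_le_sum_abs _ _).trans (Finset.sum_le_sum fun i _ => ?_)
  rw [abs_mul]
  exact mul_le_mul_of_nonneg_left (hM i x) (abs_nonneg _)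

theorem integrable_comp_haarSum {U : ℝ → ℝ → ℝ} (hU : Continuous fun z : ℝ × ℝ => U z.1 z.2)
    (a b : ℕ → ℝ) (N : ℕ) :
    Integrable (fun x => U (haarSum a N x) (haarSum b N x)) lebesgue01 := by
  obtain ⟨M, hM⟩ := exists_abs_haarSum_le a N
  obtain ⟨M', hM'⟩ := exists_abs_haarSum_le b N
  obtain ⟨C, hC⟩ := ((isCompact_Icc (a := -M) (b := M)).prod
    (isCompact_Icc (a := -M') (b := M'))).exists_bound_of_continuousOn hU.continuousOn
  refine Integrable.of_bound (C := C) ?_ (Eventually.of_forall fun x => ?_)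
  · exact (hU.measurable.comp
      ((measurable_haarSum a N).prodMk (measurable_haarSum b N))).aestronglyMeasurable
  · exact hC (haarSum a N x, haarSum b N x) ⟨abs_le.1 (hM x), abs_le.1 (hM' x)⟩

theorem integral_comp_haarSum_nonpos {U : ℝ → ℝ → ℝ} (hU : Continuous fun z : ℝ × ℝ => U z.1 z.2)
    (h0 : ∀ x y, |y| ≤ |x| → U x y ≤ 0)
    (hstep : ∀ x y h k, k = h ∨ k = -h → U (x + h) (y + k) + U (x - h) (y - k) ≤ 2 * U x y)
    (a b : ℕ → ℝ) (hab : ∀ i, b i = a i ∨ b i = -a i) (N : ℕ) :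
    ∫ x, U (haarSum a N x) (haarSum b N x) ∂lebesgue01 ≤ 0 := by
  induction N with
  | zero => exact integral_nonpos fun x => h0 _ _ (by simp [haarSum])
  | succ N ih =>
    rcases haar_index_cases N with rfl | ⟨n, q, hq, rfl⟩
    -- The first Haar function is constant on [0, 1), so the two-sided step does not apply; the
    -- one-term sums have equal modulus and U ≤ 0 pointwise.
    · refine integral_nonpos fun x => h0 _ _ ?_
      rcases hab 0 with h | h <;> simp [haarSum, h]
    · refine le_trans ?_ ih
      have hconst : ∀ c : ℕ → ℝ, ∀ x ∈ dyadicIco n q, ∀ y ∈ dyadicIco n q,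
          haarSum c (2 ^ n + q) x = haarSum c (2 ^ n + q) y := fun c x hx y hy =>
        Finset.sum_congr rfl fun i hi => by
          rw [haar_eq_of_mem_dyadicIco hq (Finset.mem_range.1 hi) hx hy]
      have := integral_comp_add_haar_le hq (integrable_comp_haarSum hU a b (2 ^ n + q)) (hconst a)
        (hconst b) (a := a (2 ^ n + q)) (b := b (2 ^ n + q)) fun x y => hstep x y _ _ (by
          rcases hab (2 ^ n + q) with h | h <;> simp [h])
      simpa only [haarSum, Finset.sum_range_succ] using this

/-- Burkholder's inequality for `±1` transforms of Haar sums. -/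
theorem exists_integral_abs_haarSum_rpow_le {p : ℝ} (hp : 1 < p) : ∃ K, 0 ≤ K ∧
    ∀ (a b : ℕ → ℝ), (∀ i, b i = a i ∨ b i = -a i) → ∀ N,
      ∫ x, |haarSum b N x| ^ p ∂lebesgue01 ≤ K * ∫ x, |haarSum a N x| ^ p ∂lebesgue01 := by
  obtain ⟨U, K, hK, hU, h0, hmaj, hstep⟩ := exists_burkholder_function hp
  refine ⟨K, hK, fun a b hab N => ?_⟩
  have hUint := integrable_comp_haarSum hU a b N
  have hpow : Continuous fun z : ℝ × ℝ => |z.1| ^ p :=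
    Continuous.rpow_const (by fun_prop) fun _ => Or.inr (by linarith)
  have ha := integrable_comp_haarSum (U := fun x _ => |x| ^ p) hpow a b N
  have hb := integrable_comp_haarSum (U := fun x _ => |x| ^ p) hpow b a N
  calc ∫ x, |haarSum b N x| ^ p ∂lebesgue01
      ≤ ∫ x, (2 * U (haarSum a N x) (haarSum b N x) + K * |haarSum a N x| ^ p) ∂lebesgue01 :=
        integral_mono hb ((hUint.const_mul 2).add (ha.const_mul K)) fun x => hmaj _ _
    _ = 2 * ∫ x, U (haarSum a N x) (haarSum b N x) ∂lebesgue01 +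
        K * ∫ x, |haarSum a N x| ^ p ∂lebesgue01 := by
        rw [integral_add (hUint.const_mul 2) (ha.const_mul K), integral_const_mul,
          integral_const_mul]
    _ ≤ K * ∫ x, |haarSum a N x| ^ p ∂lebesgue01 := by
        linarith [integral_comp_haarSum_nonpos hU h0 hstep a b hab N]

/-! ### Norms of Haar sums in `L_p` -/

section HaarNorms

variable {p : ℝ≥0∞} [Fact (1 ≤ p)]

theorem toReal_pos_of_fact (hp' : p ≠ ∞) : 0 < p.toReal :=
  ENNReal.toReal_pos (zero_lt_one.trans_le (Fact.out : 1 ≤ p)).ne' hp'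

theorem norm_rpow_eq_integral (hp' : p ≠ ∞) (f : Lp01 p) :
    ‖f‖ ^ p.toReal = ∫ x, |f x| ^ p.toReal ∂lebesgue01 := by
  have hP := toReal_pos_of_fact hp'
  have hp0 : p ≠ 0 := (zero_lt_one.trans_le (Fact.out : 1 ≤ p)).ne'
  rw [Lp.norm_def, (Lp.memLp f).eLpNorm_eq_integral_rpow_norm hp0 hp',
    ENNReal.toReal_ofReal (by positivity), Real.rpow_inv_rpow (by positivity) hP.ne']
  rfl

omit [Fact (1 ≤ p)] in
theorem coeFn_sum_haarClass (a : ℕ → ℝ) (s : Finset ℕ) :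
    ((∑ i ∈ s, a i • haarClass p i : Lp01 p) : ℝ → ℝ) =ᵐ[lebesgue01]
      fun x => ∑ i ∈ s, a i * haar i x := by
  have h : ∀ i, ∀ᵐ x ∂lebesgue01, (a i • haarClass p i : Lp01 p) x = a i * haar i x := by
    intro i
    filter_upwards [Lp.coeFn_smul (a i) (haarClass p i), (memLp_haar p i).coeFn_toLp] with x h1 h2
    rw [h1, Pi.smul_apply, haarClass, h2, smul_eq_mul]
  filter_upwards [Lp.coeFn_fun_finsetSum s fun i => (a i • haarClass p i : Lp01 p),
    ae_all_iff.2 h] with x h1 h2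
  rw [h1]
  exact Finset.sum_congr rfl fun i _ => h2 i

theorem norm_sum_haarClass_rpow (hp' : p ≠ ∞) (a : ℕ → ℝ) (s : Finset ℕ) :
    ‖∑ i ∈ s, a i • haarClass p i‖ ^ p.toReal =
      ∫ x, |∑ i ∈ s, a i * haar i x| ^ p.toReal ∂lebesgue01 := by
  rw [norm_rpow_eq_integral hp']
  refine integral_congr_ae ?_
  filter_upwards [coeFn_sum_haarClass (p := p) a s] with x hx
  rw [hx]

theorem norm_haarClass_rpow (hp' : p ≠ ∞) (j : ℕ) :
    ‖haarClass p j‖ ^ p.toReal = ∫ x, |haar j x| ^ p.toReal ∂lebesgue01 := by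
  simpa using norm_sum_haarClass_rpow hp' (fun _ => 1) {j}

/-- The dyadic interval supporting `haar j`, for `j ≠ 0`. -/
def haarSupport (j : ℕ) : Set ℝ := dyadicIco (Nat.log 2 j) (j - 2 ^ Nat.log 2 j)

theorem log_two_pow_add {n q : ℕ} (hq : q < 2 ^ n) : Nat.log 2 (2 ^ n + q) = n :=
  Nat.log_eq_of_pow_le_of_lt_pow (by omega) (by rw [pow_succ]; omega)

theorem haarSupport_two_pow_add {n q : ℕ} (hq : q < 2 ^ n) :
    haarSupport (2 ^ n + q) = dyadicIco n q := by
  rw [haarSupport, log_two_pow_add hq, Nat.add_sub_cancel_left]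

theorem eq_of_mem_haarSupport {i j : ℕ} (hi : i ≠ 0) (hj : j ≠ 0) {x : ℝ}
    (hxi : x ∈ haarSupport i) (hxj : x ∈ haarSupport j) (h : Nat.log 2 i = Nat.log 2 j) :
    i = j := by
  have hi' := Nat.pow_log_le_self 2 hi
  have hj' := Nat.pow_log_le_self 2 hj
  unfold haarSupport at hxi hxj
  rw [h] at hxi hi'
  have := dyadicIco_unique hxi hxj
  omega

theorem abs_haar {j : ℕ} (hj : j ≠ 0) (x : ℝ) :
    |haar j x| = (haarSupport j).indicator (fun _ => (2 : ℝ) ^ ((Nat.log 2 j : ℝ) / 2)) x := by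
  obtain ⟨n, q, hq, rfl⟩ := (haar_index_cases j).resolve_left hj
  have h0 : (0 : ℝ) ≤ 2 ^ ((n : ℝ) / 2) := by positivity
  rw [haarSupport_two_pow_add hq, log_two_pow_add hq, haar_two_pow_add hq, Pi.sub_apply]
  by_cases hx : x ∈ dyadicIco n q
  · rw [indicator_of_mem hx]
    rcases dyadicIco_children hx with h | h
    · rw [indicator_of_mem h, indicator_of_notMem
        (fun h' => by have := dyadicIco_unique h h'; omega), sub_zero, abs_of_nonneg h0]
    · rw [indicator_of_mem h, indicator_of_notMem
        (fun h' => by have := dyadicIco_unique h h'; omega), zero_sub, abs_neg, abs_of_nonneg h0]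
  · rw [indicator_of_notMem hx, indicator_of_notMem, indicator_of_notMem, sub_zero, abs_zero]
    · intro h
      have := dyadicIco_parent h
      rw [show (2 * q + 1) / 2 = q by omega] at this
      exact hx this
    · intro h
      have := dyadicIco_parent h
      rw [show 2 * q / 2 = q by omega] at this
      exact hx this

theorem norm_haarClass_zero (hp' : p ≠ ∞) : ‖haarClass p 0‖ = 1 := by
  have hP := toReal_pos_of_fact hp'
  refine Real.rpow_left_injOn hP.ne' (norm_nonneg _) (zero_le_one (α := ℝ)) ?_
  have e : (fun x => |haar 0 x| ^ p.toReal) = (dyadicIco 0 0).indicator fun _ => (1 : ℝ) := by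
    ext x
    rw [haar_zero]
    by_cases hx : x ∈ dyadicIco 0 0 <;> simp [hx, hP.ne']
  beta_reduce
  rw [norm_haarClass_rpow hp', e, integral_indicator_const _ (measurableSet_dyadicIco _ _),
    measureReal_dyadicIco (by norm_num)]
  norm_num

theorem two_rpow_inv_rpow (hp' : p ≠ ∞) : ((2 : ℝ) ^ (1 / p.toReal)) ^ p.toReal = 2 := by
  rw [← Real.rpow_mul (by norm_num), one_div_mul_cancel (toReal_pos_of_fact hp').ne',
    Real.rpow_one]

theorem two_rpow_inv_pow_rpow (hp' : p ≠ ∞) (n : ℕ) :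
    (((2 : ℝ) ^ (1 / p.toReal)) ^ n) ^ p.toReal = 2 ^ n := by
  rw [← Real.rpow_natCast_mul (by positivity), mul_comm, Real.rpow_mul_natCast (by positivity),
    two_rpow_inv_rpow hp']

theorem norm_haarClass (hp' : p ≠ ∞) {j : ℕ} (hj : j ≠ 0) :
    ‖haarClass p j‖ =
      2 ^ ((Nat.log 2 j : ℝ) / 2) * (((2 : ℝ) ^ (1 / p.toReal)) ^ Nat.log 2 j)⁻¹ := by
  have hP := toReal_pos_of_fact hp'
  refine Real.rpow_left_injOn hP.ne' (norm_nonneg _)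
    (show (0 : ℝ) ≤ _ by positivity) ?_
  have e : (fun x => |haar j x| ^ p.toReal) =
      (haarSupport j).indicator fun _ => ((2 : ℝ) ^ ((Nat.log 2 j : ℝ) / 2)) ^ p.toReal := by
    ext x
    rw [abs_haar hj]
    by_cases hx : x ∈ haarSupport j <;> simp [hx, hP.ne']
  have hlt : j - 2 ^ Nat.log 2 j < 2 ^ Nat.log 2 j := by
    have := Nat.lt_pow_succ_log_self one_lt_two j
    rw [pow_succ] at this
    omega
  beta_reduce
  rw [norm_haarClass_rpow hp', e, haarSupport,
    integral_indicator_const _ (measurableSet_dyadicIco _ _), measureReal_dyadicIco hlt,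
    Real.mul_rpow (by positivity) (by positivity), Real.inv_rpow (by positivity),
    two_rpow_inv_pow_rpow hp', smul_eq_mul]
  ring

theorem haarClass_ne_zero (hp' : p ≠ ∞) (j : ℕ) : haarClass p j ≠ 0 := by
  rw [← norm_pos_iff]
  rcases eq_or_ne j 0 with rfl | hj
  · rw [norm_haarClass_zero hp']
    exact one_pos
  · rw [norm_haarClass hp' hj]
    positivity

theorem norm_haarLp (hp' : p ≠ ∞) (j : ℕ) : ‖haarLp p j‖ = 1 :=
  norm_smul_inv_norm (𝕜 := ℝ) (haarClass_ne_zero hp' j)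

omit [Fact (1 ≤ p)] in
theorem sum_smul_haarLp (a : ℕ → ℝ) (s : Finset ℕ) :
    ∑ i ∈ s, a i • haarLp p i = ∑ i ∈ s, (a i * ‖haarClass p i‖⁻¹) • haarClass p i :=
  Finset.sum_congr rfl fun i _ => by rw [haarLp, smul_smul]

/-- `haar j / ‖haar j‖_p` has modulus `2 ^ (n / p)` on its support, `n` being the level of `j`. -/
theorem abs_normalized_haar (hp' : p ≠ ∞) {j : ℕ} (hj : j ≠ 0) (x : ℝ) :
    ‖haarClass p j‖⁻¹ * |haar j x| =
      (haarSupport j).indicator (fun _ => ((2 : ℝ) ^ (1 / p.toReal)) ^ Nat.log 2 j) x := by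
  rw [norm_haarClass hp' hj, abs_haar hj]
  by_cases hx : x ∈ haarSupport j
  · rw [indicator_of_mem hx, indicator_of_mem hx]
    have : (2 : ℝ) ^ ((Nat.log 2 j : ℝ) / 2) ≠ 0 := by positivity
    field_simp
  · simp [hx]

theorem integrable_abs_sum_haar_rpow (hp' : p ≠ ∞) (a : ℕ → ℝ) (s : Finset ℕ) :
    Integrable (fun x => |∑ i ∈ s, a i * haar i x| ^ p.toReal) lebesgue01 := by
  have hp0 : p ≠ 0 := (zero_lt_one.trans_le (Fact.out : 1 ≤ p)).ne'
  have : MemLp (fun x => ∑ i ∈ s, a i * haar i x) p lebesgue01 :=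
    memLp_finsetSum s fun i _ => (memLp_haar p i).const_mul (a i)
  exact this.integrable_norm_rpow hp0 hp'

/-! ### The Haar system is unconditional -/

/-- Restriction to the indices in s is the average of the identity and of the transform that changes
the signs outside s, to which Burkholder's inequality applies. -/
theorem exists_norm_sum_haarLp_le (hp : 1 < p) (hp' : p ≠ ∞) :
    ∃ K, 0 ≤ K ∧ ∀ (a : ℕ → ℝ) (N : ℕ) (s : Finset ℕ), s ⊆ Finset.range N →
      ‖∑ i ∈ s, a i • haarLp p i‖ ≤ K * ‖∑ i ∈ Finset.range N, a i • haarLp p i‖ := by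
  have hP := toReal_pos_of_fact hp'
  have hP1 : 1 < p.toReal := by
    rw [← ENNReal.toReal_one]
    exact (ENNReal.toReal_lt_toReal ENNReal.one_ne_top hp').2 hp
  obtain ⟨K, hK, h⟩ := exists_integral_abs_haarSum_rpow_le hP1
  have key : ∀ (a b : ℕ → ℝ), (∀ i, b i = a i ∨ b i = -a i) → ∀ N,
      ‖∑ i ∈ Finset.range N, b i • haarLp p i‖ ≤
        K ^ (1 / p.toReal) * ‖∑ i ∈ Finset.range N, a i • haarLp p i‖ := by
    intro a b hab N
    rw [← Real.rpow_le_rpow_iff (norm_nonneg _) (by positivity) hP,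
      Real.mul_rpow (by positivity) (norm_nonneg _), ← Real.rpow_mul hK,
      one_div_mul_cancel hP.ne', Real.rpow_one, sum_smul_haarLp, sum_smul_haarLp,
      norm_sum_haarClass_rpow hp', norm_sum_haarClass_rpow hp']
    refine h _ _ (fun i => ?_) N
    rcases hab i with e | e <;> simp [e]
  refine ⟨(1 + K ^ (1 / p.toReal)) / 2, by positivity, fun a N s hs => ?_⟩
  have hsum : ∑ i ∈ s, a i • haarLp p i = (1 / 2 : ℝ) • (∑ i ∈ Finset.range N, a i • haarLp p i +
      ∑ i ∈ Finset.range N, (if i ∈ s then a i else -a i) • haarLp p i) := by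
    rw [← Finset.sum_add_distrib, Finset.smul_sum, ← Finset.inter_eq_right.2 hs,
      ← Finset.sum_ite_mem]
    refine Finset.sum_congr rfl fun i hi => ?_
    by_cases his : i ∈ s
    · have : i ∈ Finset.range N ∩ s := Finset.mem_inter.2 ⟨hi, his⟩
      simp only [his, if_true, this, ← add_smul, smul_smul]
      congr 1; ring
    · have : i ∉ Finset.range N ∩ s := fun h => his (Finset.mem_inter.1 h).2
      simp [his]
  have h2 := key a (fun i => if i ∈ s then a i else -a i)
    (fun i => by by_cases his : i ∈ s <;> simp [his]) N
  rw [hsum, norm_smul, Real.norm_of_nonneg (by norm_num)]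
  have h3 := norm_add_le (∑ i ∈ Finset.range N, a i • haarLp p i)
    (∑ i ∈ Finset.range N, (if i ∈ s then a i else -a i) • haarLp p i)
  linarith

/-! ### The Haar system is democratic -/

/-- A sum of distinct powers of r is at most r/(r - 1) times its largest term, and the P-th power of
that term occurs on the right. -/
theorem sum_pow_rpow_le {r P : ℝ} (hr : 1 < r) (hP : 0 < P) (T : Finset ℕ) :
    (∑ n ∈ T, r ^ n) ^ P ≤ (r / (r - 1)) ^ P * ∑ n ∈ T, (r ^ n) ^ P := by
  have hr0 : 0 < r := by linarith
  have hr1 : 0 < r - 1 := by linarith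
  rcases T.eq_empty_or_nonempty with rfl | hT
  · simp [hP.ne']
  obtain ⟨M, hM, hmax⟩ := T.exists_max_image id hT
  have h1 : ∑ n ∈ T, r ^ n ≤ r / (r - 1) * r ^ M := by
    calc ∑ n ∈ T, r ^ n ≤ ∑ n ∈ Finset.range (M + 1), r ^ n :=
          Finset.sum_le_sum_of_subset_of_nonneg
            (fun n hn => Finset.mem_range.2 (Nat.lt_succ_of_le (hmax n hn)))
            fun _ _ _ => by positivity
      _ = (r ^ (M + 1) - 1) / (r - 1) := geom_sum_eq hr.ne' _
      _ ≤ r ^ (M + 1) / (r - 1) := by gcongr; linarith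
      _ = _ := by rw [pow_succ]; ring
  calc (∑ n ∈ T, r ^ n) ^ P ≤ (r / (r - 1) * r ^ M) ^ P :=
        Real.rpow_le_rpow (Finset.sum_nonneg fun _ _ => by positivity) h1 hP.le
    _ = (r / (r - 1)) ^ P * (r ^ M) ^ P := Real.mul_rpow (by positivity) (by positivity)
    _ ≤ _ := by
        gcongr
        exact Finset.single_le_sum (f := fun n => (r ^ n) ^ P) (fun _ _ => by positivity) hM

theorem one_lt_two_rpow_inv (hp' : p ≠ ∞) : 1 < (2 : ℝ) ^ (1 / p.toReal) :=
  Real.one_lt_rpow one_lt_two (one_div_pos.2 (toReal_pos_of_fact hp'))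

/-- At most one function of each level is nonzero at x, so the nonzero terms are distinct powers of
2^{1/p}. The index 0 is excluded because `haar 0` and `haar 1` both have modulus 1 on [0, 1). -/
theorem sum_normalized_haar_rpow_le (hp' : p ≠ ∞) {s : Finset ℕ} (hs : 0 ∉ s) (x : ℝ) :
    (∑ i ∈ s, ‖haarClass p i‖⁻¹ * |haar i x|) ^ p.toReal ≤
      (2 ^ (1 / p.toReal) / (2 ^ (1 / p.toReal) - 1)) ^ p.toReal *
        ∑ i ∈ s, (‖haarClass p i‖⁻¹ * |haar i x|) ^ p.toReal := by
  classical
  have hP := toReal_pos_of_fact hp'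
  have hne : ∀ i ∈ s, i ≠ 0 := fun i hi h => hs (h ▸ hi)
  set r : ℝ := 2 ^ (1 / p.toReal) with hr
  set T := s.filter fun i => x ∈ haarSupport i with hT
  have hinj : Set.InjOn (Nat.log 2) (T : Set ℕ) := by
    intro i hi j hj h
    rw [Finset.mem_coe, hT, Finset.mem_filter] at hi hj
    exact eq_of_mem_haarSupport (hne i hi.1) (hne j hj.1) hi.2 hj.2 h
  have e1 : ∑ i ∈ s, ‖haarClass p i‖⁻¹ * |haar i x| = ∑ n ∈ T.image (Nat.log 2), r ^ n := by
    rw [Finset.sum_image hinj, hT, Finset.sum_filter]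
    refine Finset.sum_congr rfl fun i hi => ?_
    rw [abs_normalized_haar hp' (hne i hi)]
    by_cases hx : x ∈ haarSupport i <;> simp [hx, hr]
  have e2 : ∑ i ∈ s, (‖haarClass p i‖⁻¹ * |haar i x|) ^ p.toReal =
      ∑ n ∈ T.image (Nat.log 2), (r ^ n) ^ p.toReal := by
    rw [Finset.sum_image hinj, hT, Finset.sum_filter]
    refine Finset.sum_congr rfl fun i hi => ?_
    rw [abs_normalized_haar hp' (hne i hi)]
    by_cases hx : x ∈ haarSupport i <;> simp [hx, hr, hP.ne']
  rw [e1, e2]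
  exact sum_pow_rpow_le (one_lt_two_rpow_inv hp') hP _

theorem integral_normalized_haar_rpow (hp' : p ≠ ∞) (i : ℕ) :
    ∫ x, (‖haarClass p i‖⁻¹ * |haar i x|) ^ p.toReal ∂lebesgue01 = 1 := by
  have h0 : ‖haarClass p i‖ ≠ 0 := norm_ne_zero_iff.2 (haarClass_ne_zero hp' i)
  have h : ‖haarLp p i‖ ^ p.toReal = 1 := by rw [norm_haarLp hp', Real.one_rpow]
  have e := sum_smul_haarLp (p := p) (fun _ => 1) {i}
  simp only [Finset.sum_singleton, one_smul, one_mul] at e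
  have := norm_sum_haarClass_rpow hp' (fun i => ‖haarClass p i‖⁻¹) {i}
  simp only [Finset.sum_singleton, ← e, h] at this
  rw [this]
  refine integral_congr_ae (Eventually.of_forall fun x => ?_)
  simp [abs_mul]

theorem integrable_normalized_haar_rpow (hp' : p ≠ ∞) (i : ℕ) :
    Integrable (fun x => (‖haarClass p i‖⁻¹ * |haar i x|) ^ p.toReal) lebesgue01 := by
  have := integrable_abs_sum_haar_rpow hp' (fun i => ‖haarClass p i‖⁻¹) {i}
  simpa [abs_mul] using this

/-- Integrating the pointwise comparison turns the p-th power of the norm into a sum of integrals,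
each equal to 1, which produces the cardinality of s. -/
theorem exists_norm_sum_haarLp_le_card (hp' : p ≠ ∞) :
    ∃ D, 0 ≤ D ∧ ∀ (a : ℕ → ℝ) (t : ℝ) (s : Finset ℕ), 0 ≤ t → (∀ i ∈ s, |a i| ≤ t) →
      ‖∑ i ∈ s, a i • haarLp p i‖ ≤ D * t * (s.card : ℝ) ^ (1 / p.toReal) := by
  have hP := toReal_pos_of_fact hp'
  have hr := one_lt_two_rpow_inv hp'
  set B : ℝ := 2 ^ (1 / p.toReal) / (2 ^ (1 / p.toReal) - 1) with hB
  have hB0 : 0 ≤ B := div_nonneg (by positivity) (by linarith)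
  have key : ∀ (a : ℕ → ℝ) (t : ℝ) (s : Finset ℕ), 0 ≤ t → 0 ∉ s → (∀ i ∈ s, |a i| ≤ t) →
      ‖∑ i ∈ s, a i • haarLp p i‖ ≤ B * t * (s.card : ℝ) ^ (1 / p.toReal) := by
    intro a t s ht hs hat
    rw [← Real.rpow_le_rpow_iff (norm_nonneg _) (by positivity) hP,
      Real.mul_rpow (by positivity) (by positivity), ← Real.rpow_mul (by positivity),
      one_div_mul_cancel hP.ne', Real.rpow_one, sum_smul_haarLp, norm_sum_haarClass_rpow hp']
    have hint : Integrable (fun x => (B * t) ^ p.toReal *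
        ∑ i ∈ s, (‖haarClass p i‖⁻¹ * |haar i x|) ^ p.toReal) lebesgue01 :=
      (integrable_finsetSum s fun i _ => integrable_normalized_haar_rpow hp' i).const_mul _
    calc _ ≤ ∫ x, (B * t) ^ p.toReal *
          ∑ i ∈ s, (‖haarClass p i‖⁻¹ * |haar i x|) ^ p.toReal ∂lebesgue01 := by
          refine integral_mono (integrable_abs_sum_haar_rpow hp' _ s) hint fun x => ?_
          have h1 : |∑ i ∈ s, a i * ‖haarClass p i‖⁻¹ * haar i x| ≤
              t * ∑ i ∈ s, ‖haarClass p i‖⁻¹ * |haar i x| := by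
            rw [Finset.mul_sum]
            refine (Finset.abs_sum_le_sum_abs _ _).trans (Finset.sum_le_sum fun i hi => ?_)
            rw [mul_assoc, abs_mul, abs_mul, abs_inv, abs_norm]
            exact mul_le_mul_of_nonneg_right (hat i hi) (by positivity)
          calc _ ≤ (t * ∑ i ∈ s, ‖haarClass p i‖⁻¹ * |haar i x|) ^ p.toReal :=
                Real.rpow_le_rpow (abs_nonneg _) h1 hP.le
            _ = t ^ p.toReal * (∑ i ∈ s, ‖haarClass p i‖⁻¹ * |haar i x|) ^ p.toReal :=
                Real.mul_rpow ht (Finset.sum_nonneg fun _ _ => by positivity)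
            _ ≤ t ^ p.toReal * (B ^ p.toReal *
                  ∑ i ∈ s, (‖haarClass p i‖⁻¹ * |haar i x|) ^ p.toReal) :=
                mul_le_mul_of_nonneg_left (sum_normalized_haar_rpow_le hp' hs x) (by positivity)
            _ = _ := by rw [Real.mul_rpow hB0 ht]; ring
      _ = (B * t) ^ p.toReal * s.card := by
          rw [integral_const_mul, integral_finsetSum s fun i _ =>
            integrable_normalized_haar_rpow hp' i]
          simp [integral_normalized_haar_rpow hp']
  -- The summand 1 pays for the index 0, which is split off and estimated by the triangle
  -- inequality.
  refine ⟨1 + B, by positivity, fun a t s ht hat => ?_⟩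
  by_cases h0 : 0 ∈ s
  · have h1 := key a t (s.erase 0) ht (Finset.notMem_erase 0 s)
      fun i hi => hat i (Finset.mem_of_mem_erase hi)
    have h2 : ‖a 0 • haarLp p 0‖ ≤ t := by
      rw [norm_smul, norm_haarLp hp', mul_one]
      exact hat 0 h0
    have h3 : (1 : ℝ) ≤ (s.card : ℝ) ^ (1 / p.toReal) :=
      Real.one_le_rpow (by exact_mod_cast Finset.card_pos.2 ⟨0, h0⟩) (by positivity)
    have h4 : ((s.erase 0).card : ℝ) ^ (1 / p.toReal) ≤ (s.card : ℝ) ^ (1 / p.toReal) :=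
      Real.rpow_le_rpow (by positivity)
        (by exact_mod_cast Finset.card_le_card (Finset.erase_subset 0 s)) (by positivity)
    rw [← Finset.add_sum_erase s _ h0]
    calc _ ≤ t + B * t * ((s.erase 0).card : ℝ) ^ (1 / p.toReal) :=
          (norm_add_le _ _).trans (add_le_add h2 h1)
      _ ≤ t * (s.card : ℝ) ^ (1 / p.toReal) + B * t * (s.card : ℝ) ^ (1 / p.toReal) :=
          add_le_add (le_mul_of_one_le_right ht h3) (mul_le_mul_of_nonneg_left h4 (by positivity))
      _ = _ := by ring
  · refine (key a t s ht h0 hat).trans ?_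
    gcongr
    linarith

/-- Haar functions of the same level have disjoint supports. -/
theorem norm_sum_haarLp_of_level (hp' : p ≠ ∞) {n : ℕ} {s : Finset ℕ}
    (hs : ∀ i ∈ s, i ≠ 0 ∧ Nat.log 2 i = n) :
    ‖∑ i ∈ s, haarLp p i‖ = (s.card : ℝ) ^ (1 / p.toReal) := by
  have hP := toReal_pos_of_fact hp'
  refine Real.rpow_left_injOn hP.ne' (norm_nonneg _) (show (0 : ℝ) ≤ _ by positivity) ?_
  beta_reduce
  have e := sum_smul_haarLp (p := p) (fun _ => 1) s
  simp only [one_smul, one_mul] at e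
  rw [← Real.rpow_mul (by positivity), one_div_mul_cancel hP.ne', Real.rpow_one, e,
    norm_sum_haarClass_rpow hp']
  have hpt : ∀ x, |∑ i ∈ s, ‖haarClass p i‖⁻¹ * haar i x| ^ p.toReal =
      ∑ i ∈ s, (‖haarClass p i‖⁻¹ * |haar i x|) ^ p.toReal := by
    intro x
    by_cases h : ∃ j ∈ s, x ∈ haarSupport j
    · obtain ⟨j, hj, hx⟩ := h
      have hz : ∀ i ∈ s, i ≠ j → haar i x = 0 := by
        intro i hi hij
        have hxi : x ∉ haarSupport i := fun hxi => hij <|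
          eq_of_mem_haarSupport (hs i hi).1 (hs j hj).1 hxi hx ((hs i hi).2.trans (hs j hj).2.symm)
        rw [← abs_eq_zero, abs_haar (hs i hi).1, indicator_of_notMem hxi]
      rw [Finset.sum_eq_single_of_mem j hj fun i hi hij => by rw [hz i hi hij, mul_zero],
        Finset.sum_eq_single_of_mem j hj fun i hi hij => by
          rw [hz i hi hij, abs_zero, mul_zero, Real.zero_rpow hP.ne'], abs_mul, abs_inv, abs_norm]
    · push Not at h
      have hz : ∀ i ∈ s, haar i x = 0 := fun i hi => by
        rw [← abs_eq_zero, abs_haar (hs i hi).1, indicator_of_notMem (h i hi)]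
      rw [Finset.sum_eq_zero fun i hi => by rw [hz i hi, mul_zero],
        Finset.sum_eq_zero fun i hi => by rw [hz i hi, abs_zero, mul_zero, Real.zero_rpow hP.ne'],
        abs_zero, Real.zero_rpow hP.ne']
  simp_rw [hpt]
  rw [integral_finsetSum s fun i _ => integrable_normalized_haar_rpow hp' i]
  simp [integral_normalized_haar_rpow hp']

end HaarNorms

/-! ### Density of the span of the Haar system -/

section Density

variable {p : ℝ≥0∞} [Fact (1 ≤ p)]

/-- The class in `L_p` of the indicator function of a dyadic interval. -/
noncomputable def dyadicClass (p : ℝ≥0∞) (n q : ℕ) : Lp01 p :=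
  indicatorConstLp p (measurableSet_dyadicIco n q) (measure_ne_top lebesgue01 _) 1

/-- The indicators of the two halves of an interval are half the sum and half the difference of the
indicator of the interval and a multiple of its Haar function. -/
theorem dyadicClass_mem_span (hp' : p ≠ ∞) (n q : ℕ) (hq : q < 2 ^ n) :
    dyadicClass p n q ∈ Submodule.span ℝ (range (haarLp p)) := by
  have hmem : ∀ j, haarClass p j ∈ Submodule.span ℝ (range (haarLp p)) := by
    intro j
    have : haarClass p j = ‖haarClass p j‖ • haarLp p j := by
      rw [haarLp, smul_smul, mul_inv_cancel₀ (norm_ne_zero_iff.2 (haarClass_ne_zero hp' j)),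
        one_smul]
    rw [this]
    exact Submodule.smul_mem _ _ (Submodule.subset_span (mem_range_self j))
  induction n generalizing q with
  | zero =>
    obtain rfl : q = 0 := by simpa using hq
    convert hmem 0 using 1
    refine Lp.ext ?_
    filter_upwards [(memLp_haar p 0).coeFn_toLp, indicatorConstLp_coeFn (p := p)
      (hs := measurableSet_dyadicIco 0 0) (hμs := measure_ne_top lebesgue01 _) (c := (1 : ℝ))]
      with x h1 h2
    rw [dyadicClass, h2, haarClass, h1, haar_zero]
  | succ n ih =>
    obtain ⟨r, hr, hqr⟩ : ∃ r < 2 ^ n, q = 2 * r ∨ q = 2 * r + 1 :=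
      ⟨q / 2, by rw [pow_succ] at hq; omega, by omega⟩
    have hpar := ih r hr
    have hH := hmem (2 ^ n + r)
    have hs : (2 : ℝ) ^ ((n : ℝ) / 2) ≠ 0 := by positivity
    have hpt : ∀ (x : ℝ), (dyadicIco n r).indicator (fun _ => (1 : ℝ)) x =
        (dyadicIco (n + 1) (2 * r)).indicator (fun _ => (1 : ℝ)) x +
        (dyadicIco (n + 1) (2 * r + 1)).indicator (fun _ => (1 : ℝ)) x ∧
        ((2 : ℝ) ^ ((n : ℝ) / 2))⁻¹ * haar (2 ^ n + r) x =
        (dyadicIco (n + 1) (2 * r)).indicator (fun _ => (1 : ℝ)) x -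
        (dyadicIco (n + 1) (2 * r + 1)).indicator (fun _ => (1 : ℝ)) x := by
      intro x
      have hA : x ∈ dyadicIco (n + 1) (2 * r) → x ∈ dyadicIco n r := fun h => by
        have := dyadicIco_parent h
        rwa [show 2 * r / 2 = r by omega] at this
      have hB : x ∈ dyadicIco (n + 1) (2 * r + 1) → x ∈ dyadicIco n r := fun h => by
        have := dyadicIco_parent h
        rwa [show (2 * r + 1) / 2 = r by omega] at this
      have hAB : x ∈ dyadicIco (n + 1) (2 * r) → x ∉ dyadicIco (n + 1) (2 * r + 1) :=
        fun h h' => by have := dyadicIco_unique h h'; omega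
      rw [haar_two_pow_add hr, Pi.sub_apply]
      by_cases h1 : x ∈ dyadicIco (n + 1) (2 * r)
      · simp [h1, hA h1, hAB h1, hs]
      · by_cases h2 : x ∈ dyadicIco (n + 1) (2 * r + 1)
        · simp [h1, h2, hB h2, hs]
        · have h3 : x ∉ dyadicIco n r := fun h => (dyadicIco_children h).elim h1 h2
          simp [h1, h2, h3]
    rcases hqr with rfl | rfl
    · have e : dyadicClass p (n + 1) (2 * r) = (1 / 2 : ℝ) • (dyadicClass p n r +
          ((2 : ℝ) ^ ((n : ℝ) / 2))⁻¹ • haarClass p (2 ^ n + r)) := by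
        refine Lp.ext ?_
        filter_upwards [Lp.coeFn_smul (1 / 2 : ℝ) (dyadicClass p n r +
          ((2 : ℝ) ^ ((n : ℝ) / 2))⁻¹ • haarClass p (2 ^ n + r)),
          Lp.coeFn_add (dyadicClass p n r) (((2 : ℝ) ^ ((n : ℝ) / 2))⁻¹ • haarClass p (2 ^ n + r)),
          Lp.coeFn_smul ((2 : ℝ) ^ ((n : ℝ) / 2))⁻¹ (haarClass p (2 ^ n + r)),
          (memLp_haar p (2 ^ n + r)).coeFn_toLp,
          indicatorConstLp_coeFn (p := p) (hs := measurableSet_dyadicIco (n + 1) (2 * r))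
            (hμs := measure_ne_top lebesgue01 _) (c := (1 : ℝ)),
          indicatorConstLp_coeFn (p := p) (hs := measurableSet_dyadicIco n r)
            (hμs := measure_ne_top lebesgue01 _) (c := (1 : ℝ))] with x h1 h2 h3 h4 h5 h6
        rw [h1, Pi.smul_apply, h2, Pi.add_apply, h3, Pi.smul_apply, haarClass, h4, dyadicClass, h5,
          dyadicClass, h6, smul_eq_mul, smul_eq_mul, (hpt x).1, (hpt x).2]
        ring
      rw [e]
      exact Submodule.smul_mem _ _ (Submodule.add_mem _ hpar (Submodule.smul_mem _ _ hH))
    · have e : dyadicClass p (n + 1) (2 * r + 1) = (1 / 2 : ℝ) • (dyadicClass p n r -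
          ((2 : ℝ) ^ ((n : ℝ) / 2))⁻¹ • haarClass p (2 ^ n + r)) := by
        refine Lp.ext ?_
        filter_upwards [Lp.coeFn_smul (1 / 2 : ℝ) (dyadicClass p n r -
          ((2 : ℝ) ^ ((n : ℝ) / 2))⁻¹ • haarClass p (2 ^ n + r)),
          Lp.coeFn_sub (dyadicClass p n r) (((2 : ℝ) ^ ((n : ℝ) / 2))⁻¹ • haarClass p (2 ^ n + r)),
          Lp.coeFn_smul ((2 : ℝ) ^ ((n : ℝ) / 2))⁻¹ (haarClass p (2 ^ n + r)),
          (memLp_haar p (2 ^ n + r)).coeFn_toLp,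
          indicatorConstLp_coeFn (p := p) (hs := measurableSet_dyadicIco (n + 1) (2 * r + 1))
            (hμs := measure_ne_top lebesgue01 _) (c := (1 : ℝ)),
          indicatorConstLp_coeFn (p := p) (hs := measurableSet_dyadicIco n r)
            (hμs := measure_ne_top lebesgue01 _) (c := (1 : ℝ))] with x h1 h2 h3 h4 h5 h6
        rw [h1, Pi.smul_apply, h2, Pi.sub_apply, h3, Pi.smul_apply, haarClass, h4, dyadicClass, h5,
          dyadicClass, h6, smul_eq_mul, smul_eq_mul, (hpt x).1, (hpt x).2]
        ring
      rw [e]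
      exact Submodule.smul_mem _ _ (Submodule.sub_mem _ hpar (Submodule.smul_mem _ _ hH))

theorem ae_mem_Ico_lebesgue01 : ∀ᵐ x ∂lebesgue01, x ∈ Ico (0 : ℝ) 1 := by
  have : lebesgue01 = volume.restrict (Ico (0 : ℝ) 1) :=
    Measure.restrict_congr_set Ico_ae_eq_Icc.symm
  rw [this]
  exact ae_restrict_mem measurableSet_Ico

instance : IsProbabilityMeasure lebesgue01 := ⟨by simp [lebesgue01]⟩

/-- Continuous functions are limits of dyadic step functions. -/
theorem toLp_mem_closure_span_haarLp (hp' : p ≠ ∞) {g : ℝ → ℝ} (hg : Continuous g)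
    (hgp : MemLp g p lebesgue01) :
    hgp.toLp g ∈ closure (Submodule.span ℝ (range (haarLp p)) : Set (Lp01 p)) := by
  rw [Metric.mem_closure_iff]
  intro ε hε
  have huc := isCompact_Icc.uniformContinuousOn_of_continuous (s := Icc (0 : ℝ) 1) hg.continuousOn
  rw [Metric.uniformContinuousOn_iff] at huc
  obtain ⟨δ, hδ, hgδ⟩ := huc (ε / 2) (by positivity)
  obtain ⟨n, hn⟩ := exists_pow_lt_of_lt_one hδ (by norm_num : (1 / 2 : ℝ) < 1)
  refine ⟨∑ q ∈ Finset.range (2 ^ n), g ((q : ℝ) / 2 ^ n) • dyadicClass p n q,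
    Submodule.sum_mem _ fun q hq => Submodule.smul_mem _ _
      (dyadicClass_mem_span hp' n q (Finset.mem_range.1 hq)), ?_⟩
  have hind : ∀ q : ℕ, ∀ᵐ x ∂lebesgue01, (g ((q : ℝ) / 2 ^ n) • dyadicClass p n q : Lp01 p) x =
      g ((q : ℝ) / 2 ^ n) * (dyadicIco n q).indicator (fun _ => 1) x := by
    intro q
    filter_upwards [Lp.coeFn_smul (g ((q : ℝ) / 2 ^ n)) (dyadicClass p n q),
      indicatorConstLp_coeFn (p := p) (hs := measurableSet_dyadicIco n q)
        (hμs := measure_ne_top lebesgue01 _) (c := (1 : ℝ))] with x h1 h2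
    rw [h1, Pi.smul_apply, dyadicClass, h2, smul_eq_mul]
  have hle : ‖hgp.toLp g - ∑ q ∈ Finset.range (2 ^ n), g ((q : ℝ) / 2 ^ n) • dyadicClass p n q‖ ≤
      (lebesgue01.real univ) ^ p.toReal⁻¹ * (ε / 2) := by
    refine Lp.norm_le_of_ae_bound (by positivity) ?_
    filter_upwards [Lp.coeFn_sub (hgp.toLp g)
      (∑ q ∈ Finset.range (2 ^ n), g ((q : ℝ) / 2 ^ n) • dyadicClass p n q), hgp.coeFn_toLp,
      Lp.coeFn_fun_finsetSum (Finset.range (2 ^ n))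
        fun q => (g ((q : ℝ) / 2 ^ n) • dyadicClass p n q : Lp01 p),
      ae_all_iff.2 hind, ae_mem_Ico_lebesgue01] with x h1 h2 h3 h4 hx
    rw [h1, Pi.sub_apply, h2, h3, Finset.sum_congr rfl fun q _ => h4 q]
    obtain ⟨q, hq, hxq⟩ := exists_mem_dyadicIco n hx
    rw [Finset.sum_eq_single_of_mem q (Finset.mem_range.2 hq) fun r _ hr => by
      rw [indicator_of_notMem fun h => hr (dyadicIco_unique h hxq), mul_zero],
      indicator_of_mem hxq, mul_one, ← dist_eq_norm]
    have hq1 := dyadicIco_subset hq (left_mem_dyadicIco n q)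
    refine (hgδ x (Ico_subset_Icc_self hx) _ (Ico_subset_Icc_self hq1) ?_).le
    rw [Real.dist_eq, abs_of_nonneg (by linarith [hxq.1])]
    have := hxq.2
    rw [add_div] at this
    rw [one_div, inv_pow, ← one_div] at hn
    linarith
  rw [dist_eq_norm]
  refine hle.trans_lt ?_
  simp only [probReal_univ, Real.one_rpow, one_mul]
  linarith

theorem dense_span_haarLp (hp' : p ≠ ∞) :
    Dense (Submodule.span ℝ (range (haarLp p)) : Set (Lp01 p)) := by
  intro f
  -- It suffices to approximate by elements of the closure of the span, and this closure contains
  -- the continuous functions in L_p.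
  rw [← closure_closure, Metric.mem_closure_iff]
  intro ε hε
  obtain ⟨g, -, hfg, hg, hgp⟩ := (Lp.memLp f).exists_hasCompactSupport_eLpNorm_sub_le hp'
    (ε := ENNReal.ofReal (ε / 2)) (by simpa using hε)
  refine ⟨hgp.toLp g, toLp_mem_closure_span_haarLp hp' hg hgp, ?_⟩
  rw [dist_eq_norm, ← Lp.toLp_coeFn f (Lp.memLp f), ← MemLp.toLp_sub, Lp.norm_toLp]
  refine (ENNReal.toReal_le_of_le_ofReal (by positivity) hfg).trans_lt (by linarith)

end Density

/-! ### Grünblum's criterion -/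

section Grunblum

variable {X : Type*} [NormedAddCommGroup X] [NormedSpace ℝ X]

/-- A sequence satisfying Grünblum's condition is linearly independent and its coordinate
functionals on the span extend to continuous functionals. -/
theorem exists_biorthogonal_of_norm_sum_le {e : ℕ → X} (he : ∀ i, e i ≠ 0) {K : ℝ}
    (h : ∀ (a : ℕ → ℝ) (N n : ℕ), n ≤ N →
      ‖∑ i ∈ Finset.range n, a i • e i‖ ≤ K * ‖∑ i ∈ Finset.range N, a i • e i‖) :
    ∃ c : ℕ → StrongDual ℝ X, ∀ i j, c i (e j) = (Pi.single j (1 : ℝ) : ℕ → ℝ) i := by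
  -- Each term is a difference of two consecutive partial sums, whence the factor 2K.
  have hcoef : ∀ (a : ℕ → ℝ) (N i : ℕ), i < N →
      |a i| ≤ 2 * K * ‖e i‖⁻¹ * ‖∑ j ∈ Finset.range N, a j • e j‖ := by
    intro a N i hi
    have h1 := h a N (i + 1) hi
    have h2 := h a N i hi.le
    have h3 : ‖a i • e i‖ ≤ 2 * K * ‖∑ j ∈ Finset.range N, a j • e j‖ := by
      have : a i • e i = ∑ j ∈ Finset.range (i + 1), a j • e j - ∑ j ∈ Finset.range i, a j • e j := by
        rw [Finset.sum_range_succ]; abel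
      rw [this]
      linarith [norm_sub_le (∑ j ∈ Finset.range (i + 1), a j • e j)
        (∑ j ∈ Finset.range i, a j • e j)]
    have hpos : 0 < ‖e i‖ := norm_pos_iff.2 (he i)
    rw [norm_smul, Real.norm_eq_abs] at h3
    calc |a i| = ‖e i‖⁻¹ * (|a i| * ‖e i‖) := by field_simp
      _ ≤ ‖e i‖⁻¹ * (2 * K * ‖∑ j ∈ Finset.range N, a j • e j‖) := by gcongr
      _ = _ := by ring
  have hli : LinearIndependent ℝ e := by
    rw [linearIndependent_iff']
    intro s a hs i hi
    obtain ⟨N, hN⟩ := s.exists_nat_subset_range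
    have h1 := hcoef (fun j => if j ∈ s then a j else 0) N i (Finset.mem_range.1 (hN hi))
    have h2 : ∑ j ∈ Finset.range N, (if j ∈ s then a j else 0) • e j = 0 := by
      rw [← hs, ← Finset.sum_subset hN]
      · exact Finset.sum_congr rfl fun j hj => by rw [if_pos hj]
      · intro j _ hj
        rw [if_neg hj, zero_smul]
    rw [h2, norm_zero, mul_zero, if_pos hi] at h1
    exact abs_eq_zero.1 (le_antisymm h1 (abs_nonneg _))
  let B := Module.Basis.span hli
  have hB : ∀ j, ((B j : Submodule.span ℝ (range e)) : X) = e j := fun j =>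
    congrArg Subtype.val (Module.Basis.span_apply hli j)
  have hbound : ∀ i (x : Submodule.span ℝ (range e)),
      ‖B.coord i x‖ ≤ 2 * K * ‖e i‖⁻¹ * ‖x‖ := by
    intro i x
    obtain ⟨N, hN⟩ := (insert i (B.repr x).support).exists_nat_subset_range
    have hx : (x : X) = ∑ j ∈ Finset.range N, B.repr x j • e j := by
      conv_lhs => rw [← B.linearCombination_repr x, Finsupp.linearCombination_apply,
        Finsupp.sum_of_support_subset _ ((Finset.subset_insert _ _).trans hN) _ (by simp)]
      simp [hB]
    have := hcoef (fun j => B.repr x j) N i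
      (Finset.mem_range.1 (hN (Finset.mem_insert_self _ _)))
    rw [← hx] at this
    exact this
  -- The coordinates are bounded on the span; Hahn–Banach extends them to X.
  have hext : ∀ i, ∃ g : StrongDual ℝ X, ∀ x : Submodule.span ℝ (range e), g x = B.coord i x := by
    intro i
    obtain ⟨g, hg, -⟩ := exists_extension_norm_eq (Submodule.span ℝ (range e))
      ((B.coord i).mkContinuous (2 * K * ‖e i‖⁻¹) (hbound i))
    exact ⟨g, hg⟩
  choose c hc using hext
  refine ⟨c, fun i j => ?_⟩
  have := hc i (B j)
  rw [hB] at this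
  rw [this, Module.Basis.coord_apply, Module.Basis.repr_self, Finsupp.single_apply,
    Pi.single_apply]
  simp only [eq_comm]

/-- Grünblum's criterion. -/
theorem exists_schauderBasis_of_norm_sum_le {e : ℕ → X} (he : ∀ i, e i ≠ 0)
    (hd : Dense (Submodule.span ℝ (range e) : Set X)) {K : ℝ} (hK : 0 ≤ K)
    (h : ∀ (a : ℕ → ℝ) (N n : ℕ), n ≤ N →
      ‖∑ i ∈ Finset.range n, a i • e i‖ ≤ K * ‖∑ i ∈ Finset.range N, a i • e i‖) :
    ∃ b : SchauderBasis ℝ X, ∀ i, b i = e i := by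
  classical
  obtain ⟨c, hc⟩ := exists_biorthogonal_of_norm_sum_le he h
  have hrep : ∀ x ∈ Submodule.span ℝ (range e), ∃ N, ∀ n, N ≤ n →
      ∑ i ∈ Finset.range n, c i x • e i = x := by
    intro x hx
    induction hx using Submodule.span_induction with
    | mem x hx =>
      obtain ⟨j, rfl⟩ := hx
      refine ⟨j + 1, fun n hn => ?_⟩
      rw [Finset.sum_eq_single_of_mem j (Finset.mem_range.2 hn) fun i _ hij => by
        simp [hc, hij]]
      simp [hc]
    | zero => exact ⟨0, fun n _ => by simp⟩
    | add x y _ _ hx hy =>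
      obtain ⟨N, hN⟩ := hx
      obtain ⟨M, hM⟩ := hy
      refine ⟨max N M, fun n hn => ?_⟩
      simp only [map_add, add_smul, Finset.sum_add_distrib]
      rw [hN n (le_of_max_le_left hn), hM n (le_of_max_le_right hn)]
    | smul r x _ hx =>
      obtain ⟨N, hN⟩ := hx
      refine ⟨N, fun n hn => ?_⟩
      simp only [map_smul, smul_assoc, ← Finset.smul_sum]
      rw [hN n hn]
  have hbd : ∀ (n : ℕ) (x : X), ‖∑ i ∈ Finset.range n, c i x • e i‖ ≤ K * ‖x‖ := by
    intro n
    refine hd.induction (P := fun x => ‖∑ i ∈ Finset.range n, c i x • e i‖ ≤ K * ‖x‖) ?_ ?_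
    · intro x hx
      obtain ⟨N, hN⟩ := hrep x hx
      have := h (fun i => c i x) (max n N) n (le_max_left _ _)
      rwa [hN _ (le_max_right _ _)] at this
    · exact isClosed_le (by fun_prop) (by fun_prop)
  refine ⟨⟨e, c, fun i j => ?_, fun x => ?_⟩, fun _ => rfl⟩
  · rw [hc]
    simp only [Pi.single_apply]
    split_ifs <;> rfl
  · rw [HasSum, SummationFilter.conditional_filter_eq_map_range, tendsto_map'_iff,
      Metric.tendsto_atTop]
    intro ε hε
    -- The expansion of y is eventually exact, so the error at x equals the error at x - y, which is
    -- at most (K + 1)‖x - y‖.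
    obtain ⟨y, hy, hxy⟩ := Metric.dense_iff.1 hd x (ε / (K + 1)) (by positivity)
    obtain ⟨N, hN⟩ := hrep y hxy
    refine ⟨N, fun n hn => ?_⟩
    rw [Metric.mem_ball, dist_comm, dist_eq_norm] at hy
    have e1 : ∑ i ∈ Finset.range n, c i x • e i - x =
        ∑ i ∈ Finset.range n, c i (x - y) • e i - (x - y) := by
      simp only [map_sub, sub_smul, Finset.sum_sub_distrib]
      rw [hN n hn]
      abel
    rw [Function.comp_apply, dist_eq_norm, e1]
    calc _ ≤ K * ‖x - y‖ + ‖x - y‖ := (norm_sub_le _ _).trans (by gcongr; exact hbd n _)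
      _ = (K + 1) * ‖x - y‖ := by ring
      _ < (K + 1) * (ε / (K + 1)) := by gcongr
      _ = ε := by field_simp

end Grunblum

/-! ### Greedy approximation for unconditional democratic bases -/

section Greedy

variable {X : Type*} [NormedAddCommGroup X] [NormedSpace ℝ X]

theorem greedyApprox_eq_sum_image (b : SchauderBasis ℝ X) (m : ℕ) {k : ℕ → ℕ}
    (hk : Function.Injective k) (f : X) :
    greedyApprox b m k f = ∑ i ∈ (Finset.range m).image k, b.coord i f • b i := by
  rw [greedyApprox, Finset.sum_image fun _ _ _ _ h => hk h]

/-- The hypothesis concerns finite sums; it passes to f because the partial sums of f converge to f.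
-/
theorem norm_sum_coord_le {b : SchauderBasis ℝ X} {K : ℝ}
    (hK : ∀ (a : ℕ → ℝ) (N : ℕ) (s : Finset ℕ), s ⊆ Finset.range N →
      ‖∑ i ∈ s, a i • b i‖ ≤ K * ‖∑ i ∈ Finset.range N, a i • b i‖) (f : X) (s : Finset ℕ) :
    ‖∑ i ∈ s, b.coord i f • b i‖ ≤ K * ‖f‖ := by
  obtain ⟨N, hN⟩ := s.exists_nat_subset_range
  refine ge_of_tendsto ((b.tendsto_proj f).norm.const_mul K) ?_
  filter_upwards [eventually_ge_atTop N] with n hn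
  rw [SchauderBasis.proj_apply]
  exact hK _ n s (hN.trans (Finset.range_subset_range.2 hn))

theorem norm_sub_greedyApprox_le {b : SchauderBasis ℝ X} {K : ℝ}
    (hK : ∀ (a : ℕ → ℝ) (N : ℕ) (s : Finset ℕ), s ⊆ Finset.range N →
      ‖∑ i ∈ s, a i • b i‖ ≤ K * ‖∑ i ∈ Finset.range N, a i • b i‖) (f : X) (m : ℕ) {k : ℕ → ℕ}
    (hk : Function.Injective k) : ‖f - greedyApprox b m k f‖ ≤ (1 + K) * ‖f‖ := by
  rw [greedyApprox_eq_sum_image b m hk]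
  linarith [norm_sub_le f (∑ i ∈ (Finset.range m).image k, b.coord i f • b i),
    norm_sum_coord_le hK f ((Finset.range m).image k)]

/-- The inequality defines a closed convex set that contains every ±b_j by biorthogonality. -/
theorem sum_abs_coord_le_one_of_mem_A1Set (b : SchauderBasis ℝ X) (s : Finset ℕ) {g : X}
    (hg : g ∈ A1Set (range b)) : ∑ i ∈ s, |b.coord i g| ≤ 1 := by
  have hb : ∀ j, ∑ i ∈ s, |b.coord i (b j)| ≤ 1 := by
    intro j
    have : ∀ i, |b.coord i (b j)| = if i = j then 1 else 0 := by
      intro i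
      rw [b.ortho]
      by_cases h : i = j
      · subst h
        simp
      · simp [h]
    simp only [this, Finset.sum_ite_eq']
    split_ifs <;> simp
  have hsub : A1Set (range b) ⊆ {g | ∑ i ∈ s, |b.coord i g| ≤ 1} := by
    refine closure_minimal (convexHull_min ?_ ?_) ?_
    · rintro x (⟨j, rfl⟩ | hx)
      · exact hb j
      · obtain ⟨j, hj⟩ := hx
        have : x = -b j := by rw [hj, neg_neg]
        subst this
        simpa using hb j
    · intro x hx y hy u v hu hv huv
      calc ∑ i ∈ s, |b.coord i (u • x + v • y)|
          ≤ ∑ i ∈ s, (u * |b.coord i x| + v * |b.coord i y|) := by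
            refine Finset.sum_le_sum fun i _ => ?_
            rw [map_add, map_smul, map_smul, smul_eq_mul, smul_eq_mul]
            refine (abs_add_le _ _).trans ?_
            rw [abs_mul, abs_mul, abs_of_nonneg hu, abs_of_nonneg hv]
        _ = u * ∑ i ∈ s, |b.coord i x| + v * ∑ i ∈ s, |b.coord i y| := by
            rw [Finset.sum_add_distrib, Finset.mul_sum, Finset.mul_sum]
        _ ≤ u * 1 + v * 1 :=
            add_le_add (mul_le_mul_of_nonneg_left hx hu) (mul_le_mul_of_nonneg_left hy hv)
        _ = 1 := by rw [mul_one, mul_one, huv]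
    · exact isClosed_le (by fun_prop) continuous_const
  exact hsub hg

theorem sum_abs_coord_le_A1Norm (b : SchauderBasis ℝ X) (s : Finset ℕ) {f : X}
    (hf : A1Norm (range b) f < ∞) : ∑ i ∈ s, |b.coord i f| ≤ (A1Norm (range b) f).toReal := by
  rw [← ENNReal.ofReal_le_iff_le_toReal hf.ne]
  refine le_iInf fun M => ENNReal.ofReal_le_ofReal ?_
  obtain ⟨M, hM, hMf⟩ := M
  have := sum_abs_coord_le_one_of_mem_A1Set b s hMf
  simp only [map_smul, smul_eq_mul, abs_mul, abs_inv, abs_of_pos hM, ← Finset.mul_sum] at this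
  rwa [inv_mul_le_one₀ hM] at this

/-- The j + 1 coefficients at positions 0, …, j are all at least as large in modulus as the last of
them: the weak ℓ₁ bound, with ranks counted from 0. -/
theorem succ_mul_abs_coord_le {b : SchauderBasis ℝ X} {f : X} (hf : A1Norm (range b) f < ∞)
    {k : ℕ → ℕ} (hk : k ∈ decreasingOrderings b f) (j : ℕ) :
    ((j : ℝ) + 1) * |b.coord (k j) f| ≤ (A1Norm (range b) f).toReal := by
  obtain ⟨hinj, -, hanti⟩ := hk
  calc ((j : ℝ) + 1) * |b.coord (k j) f| = ∑ i ∈ Finset.range (j + 1), |b.coord (k j) f| := by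
        simp
    _ ≤ ∑ i ∈ Finset.range (j + 1), |b.coord (k i) f| :=
        Finset.sum_le_sum fun i hi => hanti (Nat.lt_succ_iff.1 (Finset.mem_range.1 hi))
    _ = ∑ i ∈ (Finset.range (j + 1)).image k, |b.coord i f| := by
        rw [Finset.sum_image fun _ _ _ _ h => hinj h]
    _ ≤ _ := sum_abs_coord_le_A1Norm b _ hf

variable {b : SchauderBasis ℝ X} {D θ : ℝ}

/-- The block of ranks in [m 2^i, m 2^{i+1}) has at most m 2^i terms, with coefficients at most A/(m
2^i), so `hD` bounds its norm by D A (m 2^i)^{θ-1}. -/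
theorem norm_sum_dyadic_blocks_le
    (hD : ∀ (a : ℕ → ℝ) (t : ℝ) (s : Finset ℕ), 0 ≤ t → (∀ i ∈ s, |a i| ≤ t) →
      ‖∑ i ∈ s, a i • b i‖ ≤ D * t * (s.card : ℝ) ^ θ) (hD0 : 0 ≤ D) (hθ : 0 ≤ θ)
    {a : ℕ → ℝ} {A : ℝ} (hA : 0 ≤ A) {k : ℕ → ℕ} (hk : Function.Injective k)
    (ha : ∀ j : ℕ, ((j : ℝ) + 1) * |a (k j)| ≤ A) {m : ℕ} (hm : 1 ≤ m) (r : ℕ) (J : Finset ℕ)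
    (hJ : ∀ j ∈ J, m ≤ j ∧ j < m * 2 ^ r) :
    ‖∑ j ∈ J, a (k j) • b (k j)‖ ≤
      D * A * (m : ℝ) ^ (-(1 - θ)) * ∑ i ∈ Finset.range r, ((2 : ℝ) ^ (-(1 - θ))) ^ i := by
  induction r generalizing J with
  | zero =>
    have : J = ∅ := Finset.eq_empty_of_forall_notMem fun j hj => by
      have := hJ j hj
      omega
    simp [this]
  | succ r ih =>
    rw [← Finset.sum_filter_add_sum_filter_not J (fun j => j < m * 2 ^ r), Finset.sum_range_succ,
      mul_add]
    refine (norm_add_le _ _).trans (add_le_add (ih _ fun j hj => ?_) ?_)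
    · rw [Finset.mem_filter] at hj
      exact ⟨(hJ j hj.1).1, hj.2⟩
    · set S := J.filter fun j => ¬ j < m * 2 ^ r with hS
      have hM : (0 : ℝ) < m * 2 ^ r := by positivity
      have hmem : ∀ j ∈ S, m * 2 ^ r ≤ j ∧ j < m * 2 ^ (r + 1) := fun j hj => by
        rw [hS, Finset.mem_filter] at hj
        exact ⟨not_lt.1 hj.2, (hJ j hj.1).2⟩
      have hcard : (S.card : ℝ) ≤ m * 2 ^ r := by
        have h1 : S ⊆ Finset.Ico (m * 2 ^ r) (m * 2 ^ (r + 1)) := fun j hj =>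
          Finset.mem_Ico.2 (hmem j hj)
        have h2 := Finset.card_le_card h1
        rw [Nat.card_Ico, pow_succ, ← mul_assoc] at h2
        exact_mod_cast (by omega : S.card ≤ m * 2 ^ r)
      have hsmall : ∀ i ∈ S.image k, |a i| ≤ A / (m * 2 ^ r) := by
        intro i hi
        obtain ⟨j, hj, rfl⟩ := Finset.mem_image.1 hi
        rw [le_div_iff₀' hM]
        refine le_trans (mul_le_mul_of_nonneg_right ?_ (abs_nonneg _)) (ha j)
        have : ((m * 2 ^ r : ℕ) : ℝ) ≤ j := Nat.cast_le.2 (hmem j hj).1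
        push_cast at this
        linarith
      have h3 := hD a _ (S.image k) (by positivity) hsmall
      rw [Finset.sum_image fun _ _ _ _ h => hk h, Finset.card_image_of_injective _ hk] at h3
      refine h3.trans ?_
      calc D * (A / (m * 2 ^ r)) * (S.card : ℝ) ^ θ
          ≤ D * (A / (m * 2 ^ r)) * ((m : ℝ) * 2 ^ r) ^ θ := by gcongr
        _ = D * A * ((m : ℝ) * 2 ^ r) ^ (-(1 - θ)) := by
            rw [neg_sub, Real.rpow_sub hM, Real.rpow_one]
            ring
        _ = _ := by
            rw [Real.mul_rpow (by positivity) (by positivity), ← Real.rpow_natCast_mul (by norm_num),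
              ← Real.rpow_mul_natCast (by norm_num), mul_comm (r : ℝ)]
            ring

theorem norm_sub_greedyApprox_le_A1Norm
    (hD : ∀ (a : ℕ → ℝ) (t : ℝ) (s : Finset ℕ), 0 ≤ t → (∀ i ∈ s, |a i| ≤ t) →
      ‖∑ i ∈ s, a i • b i‖ ≤ D * t * (s.card : ℝ) ^ θ) (hD0 : 0 ≤ D) (hθ : 0 ≤ θ) (hθ1 : θ < 1)
    {f : X} (hf : A1Norm (range b) f < ∞) {k : ℕ → ℕ} (hk : k ∈ decreasingOrderings b f)
    {m : ℕ} (hm : 1 ≤ m) :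
    ‖f - greedyApprox b m k f‖ ≤ D * (1 - (2 : ℝ) ^ (-(1 - θ)))⁻¹ * (m : ℝ) ^ (-(1 - θ)) *
      (A1Norm (range b) f).toReal := by
  classical
  have hx0 : (0 : ℝ) ≤ 2 ^ (-(1 - θ)) := by positivity
  have hx1 : (2 : ℝ) ^ (-(1 - θ)) < 1 := Real.rpow_lt_one_of_one_lt_of_neg (by norm_num) (by linarith)
  set A := (A1Norm (range b) f).toReal with hA
  set S := (Finset.range m).image k with hS
  obtain ⟨N₀, hN₀⟩ := S.exists_nat_subset_range
  rw [greedyApprox_eq_sum_image b m hk.1]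
  -- The expansion of f is known to converge along initial segments of the basis order, not along k;
  -- hence the bound is proved for partial sums in that order.
  refine le_of_tendsto ((b.tendsto_proj f).sub_const _).norm ?_
  filter_upwards [eventually_ge_atTop N₀] with N hN
  have hSN : S ⊆ Finset.range N := hN₀.trans (Finset.range_subset_range.2 hN)
  -- An ordering may omit indices with zero coefficient, so these are discarded before passing to
  -- ranks.
  set T := (Finset.range N \ S).filter fun i => b.coord i f ≠ 0 with hT
  set J := T.preimage k hk.1.injOn with hJ
  have hTJ : J.image k = T := by
    rw [hJ, Finset.image_preimage, Finset.filter_true_of_mem]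
    intro i hi
    refine hk.2.1 i ?_
    rw [hT, Finset.mem_filter] at hi
    exact hi.2
  have hsum : b.proj N f - ∑ i ∈ S, b.coord i f • b i = ∑ j ∈ J, b.coord (k j) f • b (k j) := by
    rw [SchauderBasis.proj_apply, ← Finset.sum_sdiff hSN, add_sub_cancel_right,
      ← Finset.sum_image (f := fun i => b.coord i f • b i) fun _ _ _ _ h => hk.1 h, hTJ, hT,
      Finset.sum_filter_of_ne]
    intro i _ hi h
    exact hi (by rw [h, zero_smul])
  obtain ⟨r, hr⟩ := J.exists_nat_subset_range
  have hJr : ∀ j ∈ J, m ≤ j ∧ j < m * 2 ^ r := by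
    intro j hj
    constructor
    · by_contra h
      rw [hJ, Finset.mem_preimage, hT, Finset.mem_filter, Finset.mem_sdiff] at hj
      exact hj.1.2 (Finset.mem_image_of_mem k (Finset.mem_range.2 (not_le.1 h)))
    · have h1 := Finset.mem_range.1 (hr hj)
      have h2 : r < 2 ^ r := Nat.lt_two_pow_self
      nlinarith
  rw [hsum]
  refine (norm_sum_dyadic_blocks_le hD hD0 hθ (a := fun i => b.coord i f) ENNReal.toReal_nonneg hk.1
    (succ_mul_abs_coord_le hf hk) hm r J hJr).trans ?_
  have hgeom : ∑ i ∈ Finset.range r, ((2 : ℝ) ^ (-(1 - θ))) ^ i ≤ (1 - (2 : ℝ) ^ (-(1 - θ)))⁻¹ := by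
    rw [← tsum_geometric_of_lt_one hx0 hx1]
    exact (summable_geometric_of_lt_one hx0 hx1).sum_le_tsum _ fun _ _ => by positivity
  calc _ ≤ D * A * (m : ℝ) ^ (-(1 - θ)) * (1 - (2 : ℝ) ^ (-(1 - θ)))⁻¹ := by gcongr
    _ = _ := by ring

/-- The interpolation inequality for `ℝ≥0∞`. -/
theorem ENNReal.le_mul_rpow_mul_rpow {x F A C u : ℝ≥0∞} {α : ℝ} (hα : α ∈ Icc (0 : ℝ) 1)
    (h0 : x ≤ C * F) (h1 : x ≤ C * u * A) : x ≤ C * u ^ α * (F ^ (1 - α) * A ^ α) := by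
  have hα' : 0 ≤ 1 - α := sub_nonneg.2 hα.2
  have split : ∀ y : ℝ≥0∞, y = y ^ (1 - α) * y ^ α := fun y => by
    rw [← ENNReal.rpow_add_of_nonneg _ _ hα' hα.1, sub_add_cancel, ENNReal.rpow_one]
  calc x = x ^ (1 - α) * x ^ α := split x
    _ ≤ (C * F) ^ (1 - α) * (C * u * A) ^ α :=
        mul_le_mul' (ENNReal.rpow_le_rpow h0 hα') (ENNReal.rpow_le_rpow h1 hα.1)
    _ = (C ^ (1 - α) * C ^ α) * u ^ α * (F ^ (1 - α) * A ^ α) := by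
        rw [ENNReal.mul_rpow_of_nonneg _ _ hα', ENNReal.mul_rpow_of_nonneg _ _ hα.1,
          ENNReal.mul_rpow_of_nonneg _ _ hα.1]
        ring
    _ = _ := by rw [← split C]

/-- Interpolates between the bounds by ‖f‖ and by the A₁ norm. Taking the larger of their constants
in both makes the result uniform in α. -/
theorem greedyGamma_le {K : ℝ} (hK0 : 0 ≤ K)
    (hK : ∀ (a : ℕ → ℝ) (N : ℕ) (s : Finset ℕ), s ⊆ Finset.range N →
      ‖∑ i ∈ s, a i • b i‖ ≤ K * ‖∑ i ∈ Finset.range N, a i • b i‖)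
    (hD : ∀ (a : ℕ → ℝ) (t : ℝ) (s : Finset ℕ), 0 ≤ t → (∀ i ∈ s, |a i| ≤ t) →
      ‖∑ i ∈ s, a i • b i‖ ≤ D * t * (s.card : ℝ) ^ θ) (hD0 : 0 ≤ D) (hθ : 0 ≤ θ) (hθ1 : θ < 1)
    {α : ℝ} (hα : α ∈ Icc (0 : ℝ) 1) {m : ℕ} (hm : 1 ≤ m) :
    greedyGamma b α m ≤ ENNReal.ofReal
      (max (1 + K) (D * (1 - (2 : ℝ) ^ (-(1 - θ)))⁻¹) * (m : ℝ) ^ (-(α * (1 - θ)))) := by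
  set C := max (1 + K) (D * (1 - (2 : ℝ) ^ (-(1 - θ)))⁻¹) with hC
  have hC0 : 0 ≤ C := le_max_of_le_left (by linarith)
  refine iSup_le fun f => iSup_le fun _ => iSup_le fun hf => iSup_le fun k => iSup_le fun hk => ?_
  refine ENNReal.div_le_of_le_mul ?_
  have hu : ENNReal.ofReal (C * (m : ℝ) ^ (-(α * (1 - θ)))) =
      ENNReal.ofReal C * ENNReal.ofReal ((m : ℝ) ^ (-(1 - θ))) ^ α := by
    rw [ENNReal.ofReal_mul hC0, ENNReal.ofReal_rpow_of_nonneg (by positivity) hα.1,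
      ← Real.rpow_mul (by positivity)]
    ring_nf
  rw [hu]
  refine ENNReal.le_mul_rpow_mul_rpow hα ?_ ?_
  · rw [← ofReal_norm, ← ofReal_norm, ← ENNReal.ofReal_mul hC0]
    refine ENNReal.ofReal_le_ofReal ((norm_sub_greedyApprox_le hK f m hk.1).trans ?_)
    gcongr
    exact le_max_left _ _
  · rw [← ofReal_norm, ← ENNReal.ofReal_toReal hf.ne, ← ENNReal.ofReal_mul hC0,
      ← ENNReal.ofReal_mul (by positivity)]
    refine ENNReal.ofReal_le_ofReal
      ((norm_sub_greedyApprox_le_A1Norm hD hD0 hθ hθ1 hf hk hm).trans ?_)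
    gcongr
    exact le_max_right _ _

theorem greedyGammaPerm_le_greedyGamma (b : SchauderBasis ℝ X) (α : ℝ) (m : ℕ) :
    greedyGammaPerm b α m ≤ greedyGamma b α m := by
  refine iSup_mono fun f => iSup_mono fun _ => iSup_mono fun _ => iSup_mono fun k =>
    iSup_mono' fun hk => ⟨⟨hk.1.1, fun n _ => hk.1.2 n, hk.2⟩, le_rfl⟩

end Greedy

/-! ### The lower bound -/

section LowerBound

variable {X : Type*} [NormedAddCommGroup X] [NormedSpace ℝ X]

/-- The involution of `ℕ` that interchanges `{0, …, M - 1}` and `{L, …, L + M - 1}`. -/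
def blockSwap (L M j : ℕ) : ℕ :=
  if j < M then L + j else if L ≤ j ∧ j < L + M then j - L else j

theorem blockSwap_bijective {L M : ℕ} (h : M ≤ L) : Function.Bijective (blockSwap L M) := by
  refine Function.Involutive.bijective fun j => ?_
  unfold blockSwap
  split_ifs <;> omega

theorem coord_sum_block (b : SchauderBasis ℝ X) {L M : ℕ} (h : M ≤ L) (j : ℕ) :
    b.coord (blockSwap L M j) (∑ q ∈ Finset.range M, b (L + q)) = if j < M then 1 else 0 := by
  rw [map_sum]
  split_ifs with hj
  · rw [Finset.sum_eq_single_of_mem j (Finset.mem_range.2 hj)]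
    · simp [blockSwap, hj, b.ortho]
    · intro q _ hq
      have : blockSwap L M j ≠ L + q := by
        unfold blockSwap
        split_ifs
        omega
      simp [b.ortho, this]
  · refine Finset.sum_eq_zero fun q hq => ?_
    have hq := Finset.mem_range.1 hq
    have : blockSwap L M j ≠ L + q := by
      unfold blockSwap
      split_ifs <;> omega
    simp [b.ortho, this]

/-- Along the swap the coefficients are M ones followed by zeros. As the swap is a bijection, the
example also serves for the smaller supremum over permutations. -/
theorem blockSwap_mem_decreasingPermutations (b : SchauderBasis ℝ X) {L M : ℕ} (h : M ≤ L) :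
    blockSwap L M ∈ decreasingPermutations b (∑ q ∈ Finset.range M, b (L + q)) := by
  refine ⟨blockSwap_bijective h, fun i j hij => ?_⟩
  simp only [coord_sum_block b h]
  split_ifs <;> first | omega | simp

theorem sub_greedyApprox_block (b : SchauderBasis ℝ X) {L M m : ℕ} (h : M ≤ L) (hm : m ≤ M) :
    (∑ q ∈ Finset.range M, b (L + q)) -
      greedyApprox b m (blockSwap L M) (∑ q ∈ Finset.range M, b (L + q)) =
      ∑ q ∈ Finset.Ico m M, b (L + q) := by
  have : greedyApprox b m (blockSwap L M) (∑ q ∈ Finset.range M, b (L + q)) =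
      ∑ q ∈ Finset.range m, b (L + q) := by
    refine Finset.sum_congr rfl fun q hq => ?_
    have hq : q < M := (Finset.mem_range.1 hq).trans_le hm
    rw [coord_sum_block b h, if_pos hq, one_smul, blockSwap, if_pos hq]
  rw [this, ← Finset.sum_range_add_sum_Ico _ hm, add_sub_cancel_left]

/-- Divided by M, the sum is an average of dictionary elements. -/
theorem A1Norm_sum_le (b : SchauderBasis ℝ X) (L : ℕ) {M : ℕ} (hM : 0 < M) :
    A1Norm (range b) (∑ q ∈ Finset.range M, b (L + q)) ≤ ENNReal.ofReal M := by
  have hM' : (0 : ℝ) < M := Nat.cast_pos.2 hM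
  refine iInf_le_of_le ⟨(M : ℝ), hM', subset_closure ?_⟩ le_rfl
  rw [Finset.smul_sum]
  refine (convex_convexHull ℝ _).sum_mem (fun _ _ => by positivity) ?_
    fun q _ => subset_convexHull ℝ _ (Or.inl (mem_range_self _))
  rw [Finset.sum_const, Finset.card_range, nsmul_eq_mul, mul_inv_cancel₀ hM'.ne']

theorem le_greedyGammaPerm (b : SchauderBasis ℝ X) {θ : ℝ} {L m : ℕ} (hm : 1 ≤ m)
    (hL : 2 * m ≤ L)
    (hnorm : ∀ s : Finset ℕ, (∀ q ∈ s, q < 2 * m) → ‖∑ q ∈ s, b (L + q)‖ = (s.card : ℝ) ^ θ)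
    (hθ1 : θ ≤ 1) {α : ℝ} (hα : α ∈ Icc (0 : ℝ) 1) :
    ENNReal.ofReal (1 / 2 * (m : ℝ) ^ (-(α * (1 - θ)))) ≤ greedyGammaPerm b α m := by
  have hα' : 0 ≤ 1 - α := sub_nonneg.2 hα.2
  have hm0 : (0 : ℝ) < m := Nat.cast_pos.2 hm
  -- With 2m equal coefficients, m greedy steps leave m terms, so the remainder is comparable in
  -- norm to f.
  set f := ∑ q ∈ Finset.range (2 * m), b (L + q) with hf
  have hfn : ‖f‖ = ((2 * m : ℕ) : ℝ) ^ θ := by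
    rw [hf, hnorm _ fun q hq => Finset.mem_range.1 hq, Finset.card_range]
  have hfg : ‖f - greedyApprox b m (blockSwap L (2 * m)) f‖ = (m : ℝ) ^ θ := by
    rw [hf, sub_greedyApprox_block b hL (by omega),
      hnorm _ fun q hq => (Finset.mem_Ico.1 hq).2, Nat.card_Ico]
    congr 2
    omega
  have hf0 : f ≠ 0 := by
    rw [← norm_pos_iff, hfn]
    positivity
  have hA := A1Norm_sum_le b L (M := 2 * m) (by omega)
  rw [← hf] at hA
  refine le_trans ?_ (le_iSup₂_of_le f hf0 (le_iSup₂_of_le (hA.trans_lt ENNReal.ofReal_lt_top)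
    (blockSwap L (2 * m)) (le_iSup_of_le (blockSwap_mem_decreasingPermutations b hL) le_rfl)))
  rw [← ofReal_norm, ← ofReal_norm, hfn, hfg]
  refine le_trans ?_ (ENNReal.div_le_div_left
    (mul_le_mul_right (ENNReal.rpow_le_rpow hA hα.1) _) _)
  rw [ENNReal.ofReal_rpow_of_nonneg (by positivity) hα', ENNReal.ofReal_rpow_of_nonneg
    (by positivity) hα.1, ← ENNReal.ofReal_mul (by positivity),
    ← ENNReal.ofReal_div_of_pos (by positivity)]
  refine ENNReal.ofReal_le_ofReal ?_
  have h2m : (0 : ℝ) < 2 * m := by positivity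
  push_cast
  rw [le_div_iff₀ (by positivity), ← Real.rpow_mul h2m.le, ← Real.rpow_add h2m,
    Real.mul_rpow (by norm_num) hm0.le]
  -- The exponent is a convex combination of θ and 1, hence at most 1; this is where the constant
  -- 1/2 comes from.
  have h2 : (2 : ℝ) ^ (θ * (1 - α) + α) ≤ 2 := by
    conv_rhs => rw [← Real.rpow_one 2]
    refine Real.rpow_le_rpow_of_exponent_le (by norm_num) ?_
    nlinarith
  calc 1 / 2 * (m : ℝ) ^ (-(α * (1 - θ))) *
        ((2 : ℝ) ^ (θ * (1 - α) + α) * (m : ℝ) ^ (θ * (1 - α) + α))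
      = 1 / 2 * (2 : ℝ) ^ (θ * (1 - α) + α) *
        ((m : ℝ) ^ (-(α * (1 - θ))) * (m : ℝ) ^ (θ * (1 - α) + α)) := by ring
    _ = 1 / 2 * (2 : ℝ) ^ (θ * (1 - α) + α) * (m : ℝ) ^ θ := by
        rw [← Real.rpow_add hm0]
        ring_nf
    _ ≤ 1 / 2 * 2 * (m : ℝ) ^ θ := by gcongr
    _ = (m : ℝ) ^ θ := by ring

end LowerBound

/-! ### The limit for p > 2 and the assembly of the theorem -/

theorem tendsto_rpow_mul_of_le {γ : ℕ → ℝ≥0∞} {C θ α : ℝ} (hα : 0 < α) (hθ : θ < 1 / 2)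
    (h : ∀ m : ℕ, 1 ≤ m → γ m ≤ ENNReal.ofReal (C * (m : ℝ) ^ (-(α * (1 - θ))))) :
    Tendsto (fun m : ℕ => (m : ℝ≥0∞) ^ (α / 2) * γ m) atTop (𝓝 0) := by
  -- The exponents combine to α/2 - α(1 - θ) = -α(1/2 - θ), which is negative.
  have hlim : Tendsto (fun m : ℕ => ENNReal.ofReal (C * (m : ℝ) ^ (-(α * (1 / 2 - θ))))) atTop
      (𝓝 0) := by
    have := ((tendsto_rpow_neg_atTop (y := α * (1 / 2 - θ)) (by
      apply mul_pos hα; linarith)).comp tendsto_natCast_atTop_atTop).const_mul C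
    simpa using ENNReal.tendsto_ofReal this
  refine tendsto_of_tendsto_of_tendsto_of_le_of_le' tendsto_const_nhds hlim
    (Eventually.of_forall fun _ => zero_le) ?_
  filter_upwards [eventually_ge_atTop 1] with m hm
  have hm0 : (0 : ℝ) < m := Nat.cast_pos.2 hm
  calc (m : ℝ≥0∞) ^ (α / 2) * γ m
      ≤ (m : ℝ≥0∞) ^ (α / 2) * ENNReal.ofReal (C * (m : ℝ) ^ (-(α * (1 - θ)))) := by
        gcongr
        exact h m hm
    _ = ENNReal.ofReal (C * ((m : ℝ) ^ (α / 2) * (m : ℝ) ^ (-(α * (1 - θ))))) := by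
        rw [← ENNReal.ofReal_natCast, ENNReal.ofReal_rpow_of_nonneg hm0.le (by positivity),
          ← ENNReal.ofReal_mul (by positivity)]
        ring_nf
    _ = _ := by
        rw [← Real.rpow_add hm0]
        ring_nf

theorem theorem3p3 (p : ℝ≥0∞) [Fact (1 ≤ p)] (hp : 1 < p) (hp' : p < ∞) :
    ∃ b : SchauderBasis ℝ (Lp01 p), (∀ j, b j = haarLp p j) ∧
      (∃ c C : ℝ, 0 < c ∧ 0 < C ∧ ∀ α ∈ Icc (0 : ℝ) 1, ∀ m : ℕ, 1 ≤ m →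
        ENNReal.ofReal (c * (m : ℝ) ^ (-(α * (1 - 1 / p.toReal)))) ≤ greedyGammaPerm b α m ∧
        greedyGammaPerm b α m ≤ greedyGamma b α m ∧
        greedyGamma b α m ≤ ENNReal.ofReal (C * (m : ℝ) ^ (-(α * (1 - 1 / p.toReal))))) ∧
      (2 < p → ∀ α ∈ Ioc (0 : ℝ) 1,
        Tendsto (fun m : ℕ => (m : ℝ≥0∞) ^ (α / 2) * greedyGamma b α m) atTop (𝓝 0)) := by
  have hP1 : 1 < p.toReal := by
    rw [← ENNReal.toReal_one]
    exact (ENNReal.toReal_lt_toReal ENNReal.one_ne_top hp'.ne).2 hp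
  have hθ : 0 ≤ 1 / p.toReal := by positivity
  have hθ1 : 1 / p.toReal < 1 := (div_lt_one (by linarith)).2 hP1
  obtain ⟨K, hK0, hK⟩ := exists_norm_sum_haarLp_le hp hp'.ne
  obtain ⟨D, hD0, hD⟩ := exists_norm_sum_haarLp_le_card hp'.ne
  obtain ⟨b, hb⟩ := exists_schauderBasis_of_norm_sum_le (e := haarLp p)
    (fun i => norm_ne_zero_iff.1 (by rw [norm_haarLp hp'.ne]; exact one_ne_zero))
    (dense_span_haarLp hp'.ne) hK0
    fun a N n hn => hK a N _ (Finset.range_subset_range.2 hn)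
  obtain ⟨C, hC0, hC⟩ : ∃ C : ℝ, 0 < C ∧ ∀ α ∈ Icc (0 : ℝ) 1, ∀ m : ℕ, 1 ≤ m →
      greedyGamma b α m ≤ ENNReal.ofReal (C * (m : ℝ) ^ (-(α * (1 - 1 / p.toReal)))) :=
    ⟨_, lt_max_of_lt_left (by linarith), fun α hα m hm => greedyGamma_le hK0
      (by simpa only [hb] using hK) (by simpa only [hb] using hD) hD0 hθ hθ1 hα hm⟩
  refine ⟨b, hb, ⟨1 / 2, C, by norm_num, hC0, fun α hα m hm => ⟨?_,
    greedyGammaPerm_le_greedyGamma b α m, hC α hα m hm⟩⟩, fun h2 α hα => ?_⟩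
  -- Level 2m contains 2^{2m} > 2m functions, enough for the example; its first index 2^{2m} serves
  -- as L and keeps the two swapped blocks disjoint.
  · have hlt : 2 * m < 2 ^ (2 * m) := Nat.lt_two_pow_self
    refine le_greedyGammaPerm b hm hlt.le (fun s hs => ?_) hθ1.le hα
    have := norm_sum_haarLp_of_level hp'.ne (n := 2 * m) (s := s.image (2 ^ (2 * m) + ·))
      fun i hi => by
        obtain ⟨q, hq, rfl⟩ := Finset.mem_image.1 hi
        exact ⟨by positivity, log_two_pow_add ((hs q hq).trans hlt)⟩
    rw [Finset.sum_image fun _ _ _ _ h => Nat.add_left_cancel h,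
      Finset.card_image_of_injective _ (add_right_injective _)] at this
    simpa only [hb] using this
  · have h2' : 2 < p.toReal := by
      rw [← ENNReal.toReal_ofNat]
      exact (ENNReal.toReal_lt_toReal (ENNReal.ofNat_ne_top) hp'.ne).2 h2
    exact tendsto_rpow_mul_of_le hα.1
      ((div_lt_div_iff_of_pos_left one_pos (by linarith) two_pos).2 h2')
      fun m hm => hC α ⟨hα.1.le, hα.2⟩ m hm
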